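/- Let $\mu$ be a probability measure on $\{0,1\}^n$ and let $X=(X_1,\dots,X_n)\sim\mu$. For $\Lambda\subseteq[n]$ and $\sigma\in\{0,1\}^\Lambda$ let $\Psi^{\Lambda,\sigma}$ be the $n\times n$ matrix with entries $$\Psi^{\Lambda,\sigma}(i,j)=\mathbb P(X_j=1\mid X_i=1,\ X_\ell=\sigma_\ell\ \forall \ell\in\Lambda)-\mathbb P(X_j=1\mid X_i=0,\ X_\ell=\sigma_\ell\ \forall \ell\in\Lambda)$$ if both conditioning events have positive probability, and $0$ otherwise. Let $\mathcal I^{\Lambda}$ be the $n\times n$ matrix with entries $$\mathcal I^{\Lambda}(i,j)=\mathbb P(X_j=1\mid X_i=1,\ X_\ell=1\ \forall \ell\in\Lambda)-\mathbb P(X_j=1\mid X_\ell=1\ \forall \ell\in\Lambda)$$ if $\mathbb P(X_i=1,\ X_\ell=1\ \forall\ell\in\Lambda)>0$, and $0$ otherwise. Write $\|M\|_{\ell_\infty\to\ell_\infty}=\max_i\sum_j|M_{ij}|$. The vector $X$ is *one-sided $\ell_\infty$-independent with parameter $D$* if $\|\mathcal I^\Lambda\|_{\ell_\infty\to\ell_\infty}\le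 D$ for all $\Lambda\subseteq[n]$, *two-sided $\ell_\infty$-independent with parameter $D$* if $\|\Psi^{\Lambda,\sigma}\|_{\ell_\infty\to\ell_\infty}\le D$ for all $\Lambda\subseteq[n]$ and $\sigma\in\{0,1\}^\Lambda$, and *$k$-homogeneous* if $\sum_{i=1}^n X_i=k$ almost surely. There is an absolute constant $C>0$ with the following property. Let $X$ be a $\{0,1\}^n$-valued random vector which is either $k$-homogeneous for some $k$ and one-sided $\ell_\infty$-independent with parameter $D$, or two-sided $\ell_\infty$-independent with parameter $D$. Let $A_1,\dots,A_n$ be real symmetric positive semidefinite $d\times d$ matrices, $Z=\sum_{i=1}^n X_iA_i$ and $R=\max_{i\le n}\|A_i\|$, where $\|\cdot\|$ is the $\ell_2\to\ell_2$ operator norm. Then for all $t>0$, $$\mathbb P\big(\|Z\|\ge\|\mathbb EZ\|+t\big)\le 2d\,\exp\Big(-\frac1{CD^2}\min\Big(\frac{t^2}{\|\mathbb EZ\|R},\frac tR\Big)\Big).$$ In the degenerate cases $D=0$, $R=0$ or $\mathbb EZ=0$, a positive number divided by $0$ is read as $+\infty$, and $\exp(-\infty)=0$. -/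

import Mathlib

open scoped ENNReal Matrix.Norms.L2Operator

noncomputable section

namespace MatrixBernstein

/-- The discrete cube `{0,1}^n`. -/
abbrev Cube (n : ℕ) : Type := Fin n → Fin 2

/-- The event `{x | x_i = a}`. -/
def coordEvent {n : ℕ} (i : Fin n) (a : Fin 2) : Set (Cube n) := {x | x i = a}

/-- The event `{x | x_l = σ_l for all l ∈ Λ}`, where `σ ∈ {0,1}^Λ`. -/
def pinEvent {n : ℕ} (Λ : Finset (Fin n)) (σ : Λ → Fin 2) : Set (Cube n) :=
  {x | ∀ l : Λ, x l = σ l}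

/-- The matrix with entries
`P(X_j = 1 | X_i = 1, X_Λ = σ) - P(X_j = 1 | X_i = 0, X_Λ = σ)` for `X` of law `μ`, when both
conditioning events have positive probability, and `0` otherwise. -/
def psiMatrix {n : ℕ} (μ : MeasureTheory.Measure (Cube n)) (Λ : Finset (Fin n))
    (σ : Λ → Fin 2) : Matrix (Fin n) (Fin n) ℝ :=
  open scoped Classical in
  Matrix.of fun i j =>
    if 0 < μ (coordEvent i 1 ∩ pinEvent Λ σ) ∧ 0 < μ (coordEvent i 0 ∩ pinEvent Λ σ) then
      (ProbabilityTheory.cond μ (coordEvent i 1 ∩ pinEvent Λ σ)).real (coordEvent j 1)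
        - (ProbabilityTheory.cond μ (coordEvent i 0 ∩ pinEvent Λ σ)).real (coordEvent j 1)
    else 0

/-- The matrix with entries
`P(X_j = 1 | X_i = 1, X_Λ = 1) - P(X_j = 1 | X_Λ = 1)` for `X` of law `μ`, when
`P(X_i = 1, X_Λ = 1) > 0`, and `0` otherwise. -/
def influenceMatrix {n : ℕ} (μ : MeasureTheory.Measure (Cube n)) (Λ : Finset (Fin n)) :
    Matrix (Fin n) (Fin n) ℝ :=
  open scoped Classical in
  Matrix.of fun i j =>
    if 0 < μ (coordEvent i 1 ∩ pinEvent Λ fun _ => 1) then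
      (ProbabilityTheory.cond μ (coordEvent i 1 ∩ pinEvent Λ fun _ => 1)).real (coordEvent j 1)
        - (ProbabilityTheory.cond μ (pinEvent Λ fun _ => 1)).real (coordEvent j 1)
    else 0

/-- The operator norm `ℓ_∞ → ℓ_∞`, that is, `max_i ∑_j |a_{ij}|`. -/
def linftyNorm {n : ℕ} (M : Matrix (Fin n) (Fin n) ℝ) : ℝ :=
  ⨆ i, ∑ j, |M i j|

/-- One-sided `ℓ_∞`-independence with parameter `D`. -/
def OneSidedIndep {n : ℕ} (μ : MeasureTheory.Measure (Cube n)) (D : ℝ) : Prop :=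
  ∀ Λ : Finset (Fin n), linftyNorm (influenceMatrix μ Λ) ≤ D

/-- Two-sided `ℓ_∞`-independence with parameter `D`. -/
def TwoSidedIndep {n : ℕ} (μ : MeasureTheory.Measure (Cube n)) (D : ℝ) : Prop :=
  ∀ (Λ : Finset (Fin n)) (σ : Λ → Fin 2), linftyNorm (psiMatrix μ Λ σ) ≤ D

/-- `k`-homogeneity: almost surely exactly `k` coordinates are equal to `1`. -/
def IsHomogeneous {n : ℕ} (μ : MeasureTheory.Measure (Cube n)) (k : ℕ) : Prop :=
  ∀ᵐ x ∂μ, ∑ i, (x i : ℕ) = k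

/-- The random matrix `∑ i, X_i A_i`, as a function on the cube. -/
def matrixSum {n d : ℕ} (A : Fin n → Matrix (Fin d) (Fin d) ℝ) (x : Cube n) :
    Matrix (Fin d) (Fin d) ℝ :=
  ∑ i, ((x i : ℕ) : ℝ) • A i

end MatrixBernstein

end

namespace MatrixBernstein

open Matrix NormedSpace Filter Topology
open scoped MatrixOrder

/-! ### The Lie product formula -/

section LieProduct

/-! The proof bounds `E tr exp(θ Z)` by revealing `X` gradually and following a compensated Doob
martingale. The state is the vector `u_j = g · P(X_j = 1 | revealed) - h · 1[j already revealed to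
be 1]` and the potential is `F u = tr exp (∑ u_j A_j)`. The state starts at `g · E X` and ends at
`(g - h) · X`, so if `F` decreases in mean, `g - h = θ` gives the exponential moment.

One step changes the conditional means by a centred vector `c`. Independence bounds `∑ |c_j|` by
`D`, and the symmetry of covariances turns this row bound into a column bound: the mean of `|c_j|`
is at most `2 D q_j`, where `q_j` is the probability that this step reveals `j` as a one. By
Golden–Thompson, `exp Δ ≤ 1 + Δ + Δ²` and a weighted Cauchy–Schwarz inequality, the second-order
loss is of order `g² D² R ∑ q_j tr(e^H A_j)`, which the drift `-h ∑ q_j tr(e^H A_j)` absorbs for `h`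
of order `θ² D² R` (`stepDecreasing_trace_exp`).

Under two-sided independence the next coordinate is uniform among the unrevealed ones
(`StepDecreasing.sum_reveal_coordinate_le`). In the homogeneous case it is uniform among the
unrevealed coordinates equal to one, so only conditionings on ones occur
(`StepDecreasing.sum_reveal_one_le`). Markov's inequality and a choice of `θ` finish the case `D ≥
1`; for `D < 1` the vector `X` is deterministic. -/

theorem norm_pow_sub_pow_le {𝔸 : Type*} [NormedRing 𝔸] {S T : 𝔸} {r : ℝ} (hr : 1 ≤ r) (hS : ‖S‖ ≤ r) (hT : ‖T‖ ≤ r)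
    (N : ℕ) : ‖S ^ N - T ^ N‖ ≤ N * r ^ N * ‖S - T‖ := by
  have hr0 : 0 ≤ r := zero_le_one.trans hr
  induction N with
  | zero => simp
  | succ N ih =>
    have key : S ^ (N + 1) - T ^ (N + 1) = S * (S ^ N - T ^ N) + (S - T) * T ^ N := by
      rw [pow_succ', pow_succ']; noncomm_ring
    have hTN : ‖(S - T) * T ^ N‖ ≤ ‖S - T‖ * r ^ (N + 1) := by
      -- Without `NormOneClass` the bound `‖T ^ N‖ ≤ r ^ N` may fail at `N = 0`.
      rcases Nat.eq_zero_or_pos N with rfl | hN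
      · have : ‖S - T‖ * 1 ≤ ‖S - T‖ * r := by gcongr
        simpa using this
      · calc ‖(S - T) * T ^ N‖ ≤ ‖S - T‖ * ‖T ^ N‖ := norm_mul_le _ _
          _ ≤ ‖S - T‖ * r ^ N := by
            gcongr
            exact (norm_pow_le' T hN).trans (by gcongr)
          _ ≤ ‖S - T‖ * r ^ (N + 1) := by
            gcongr
            exact N.le_succ
    rw [key]
    calc _ ≤ ‖S * (S ^ N - T ^ N)‖ + ‖(S - T) * T ^ N‖ := norm_add_le _ _
      _ ≤ r * (N * r ^ N * ‖S - T‖) + ‖S - T‖ * r ^ (N + 1) := by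
        gcongr
        exact (norm_mul_le _ _).trans (by gcongr)
      _ = _ := by push_cast; ring

variable {𝔸 : Type*} [NormedRing 𝔸] [NormedAlgebra ℝ 𝔸]

theorem norm_exp_le_of_normOneClass [NormOneClass 𝔸] [CompleteSpace 𝔸] (x : 𝔸) :
    ‖exp x‖ ≤ Real.exp ‖x‖ := by
  rw [exp_eq_tsum ℝ, Real.exp_eq_exp_ℝ, exp_eq_tsum ℝ]
  have hs : Summable fun n : ℕ => ((n.factorial : ℝ)⁻¹) • ‖x‖ ^ n :=
    expSeries_summable' (𝕂 := ℝ) ‖x‖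
  refine tsum_of_norm_bounded hs.hasSum fun n => ?_
  rw [norm_smul, smul_eq_mul, Real.norm_of_nonneg (by positivity)]
  gcongr
  exact norm_pow_le x n

/-- The **Lie product formula**. -/
theorem tendsto_exp_mul_exp_pow [NormOneClass 𝔸] [CompleteSpace 𝔸] (a b : 𝔸) :
    Tendsto (fun N : ℕ => (exp ((N : ℝ)⁻¹ • a) * exp ((N : ℝ)⁻¹ • b)) ^ N) atTop
      (𝓝 (exp (a + b))) := by
  set f : ℝ → 𝔸 := fun s => exp (s • (a + b)) - exp (s • a) * exp (s • b) with hf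
  have hder : HasDerivAt f 0 0 := by
    have h1 := hasDerivAt_exp_smul_const (𝕂 := ℝ) (a + b) (0 : ℝ)
    have h2 := hasDerivAt_exp_smul_const (𝕂 := ℝ) a (0 : ℝ)
    have h3 := hasDerivAt_exp_smul_const (𝕂 := ℝ) b (0 : ℝ)
    refine (h1.sub (h2.mul h3)).congr_deriv ?_
    simp
  have hlim : Tendsto (fun N : ℕ => (N : ℝ) * ‖f ((N : ℝ)⁻¹)‖) atTop (𝓝 0) := by
    have h0 : Tendsto (fun N : ℕ => ((N : ℝ)⁻¹)) atTop (𝓝[≠] 0) := by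
      refine tendsto_nhdsWithin_iff.2 ⟨tendsto_inv_atTop_nhds_zero_nat, ?_⟩
      filter_upwards [eventually_gt_atTop 0] with N hN
      simp [hN.ne']
    have h1 := ((hasDerivAt_iff_tendsto_slope.1 hder).comp h0).norm
    rw [norm_zero] at h1
    refine h1.congr fun N => ?_
    simp [slope, hf, norm_smul]
  have hbound : ∀ N : ℕ, 0 < N →
      ‖exp (a + b) - (exp ((N : ℝ)⁻¹ • a) * exp ((N : ℝ)⁻¹ • b)) ^ N‖
        ≤ Real.exp (‖a‖ + ‖b‖) * ((N : ℝ) * ‖f ((N : ℝ)⁻¹)‖) := by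
    intro N hN
    have hN0 : (0 : ℝ) < N := by exact_mod_cast hN
    let +nondep : NormedAlgebra ℚ 𝔸 := .restrictScalars ℚ ℝ 𝔸
    have e1 : exp (a + b) = exp ((N : ℝ)⁻¹ • (a + b)) ^ N := by
      rw [← NormedSpace.exp_nsmul, ← Nat.cast_smul_eq_nsmul ℝ, smul_smul, mul_inv_cancel₀ hN0.ne', one_smul]
    set r := Real.exp ((N : ℝ)⁻¹ * (‖a‖ + ‖b‖)) with hr
    have hr1 : 1 ≤ r := Real.one_le_exp (by positivity)
    have hS : ‖exp ((N : ℝ)⁻¹ • (a + b))‖ ≤ r := by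
      refine (norm_exp_le_of_normOneClass _).trans (Real.exp_le_exp.2 ?_)
      rw [norm_smul, Real.norm_of_nonneg (by positivity)]
      gcongr
      exact norm_add_le _ _
    have hT : ‖exp ((N : ℝ)⁻¹ • a) * exp ((N : ℝ)⁻¹ • b)‖ ≤ r := by
      refine (norm_mul_le _ _).trans ?_
      rw [hr, mul_add, Real.exp_add]
      have key : ∀ c : 𝔸, ‖exp ((N : ℝ)⁻¹ • c)‖ ≤ Real.exp ((N : ℝ)⁻¹ * ‖c‖) := fun c => by
        refine (norm_exp_le_of_normOneClass _).trans (Real.exp_le_exp.2 ?_)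
        rw [norm_smul, Real.norm_of_nonneg (by positivity)]
      gcongr <;> exact key _
    have hrN : r ^ N = Real.exp (‖a‖ + ‖b‖) := by
      rw [hr, ← Real.exp_nat_mul]; congr 1; field_simp
    rw [e1]
    refine (norm_pow_sub_pow_le hr1 hS hT N).trans (le_of_eq ?_)
    rw [hrN]; simp only [hf]; ring
  rw [tendsto_iff_norm_sub_tendsto_zero]
  have hlim' := hlim.const_mul (Real.exp (‖a‖ + ‖b‖))
  rw [mul_zero] at hlim'
  refine squeeze_zero' (Eventually.of_forall fun _ => norm_nonneg _) ?_ hlim'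
  filter_upwards [eventually_gt_atTop 0] with N hN
  rw [norm_sub_rev]
  exact hbound N hN

end LieProduct

/-! ### Trace inequalities and the Golden–Thompson inequality -/

section Trace

variable {ι : Type*} [Fintype ι]

theorem two_mul_trace_mul_le (X Y : Matrix ι ι ℝ) :
    2 * (X * Y).trace ≤ (X * Xᴴ).trace + (Y * Yᴴ).trace := by
  have h := (posSemidef_self_mul_conjTranspose (X - Yᴴ)).trace_nonneg
  have h1 : (Yᴴ * Xᴴ).trace = (X * Y).trace := by
    rw [← conjTranspose_mul, trace_conjTranspose]; simp
  have h2 : (Yᴴ * Y).trace = (Y * Yᴴ).trace := trace_mul_comm _ _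
  simp only [conjTranspose_sub, conjTranspose_conjTranspose, sub_mul, mul_sub, trace_sub, h1,
    h2] at h
  linarith

variable [DecidableEq ι]

/-- Writing `P = Bᴴ B`, cyclicity turns the trace into that of `B Q Bᴴ`. -/
theorem trace_mul_nonneg {P Q : Matrix ι ι ℝ} (hP : P.PosSemidef) (hQ : Q.PosSemidef) :
    0 ≤ (P * Q).trace := by
  obtain ⟨B, rfl⟩ := CStarAlgebra.nonneg_iff_eq_star_mul_self.1 hP.nonneg
  rw [star_eq_conjTranspose]
  rw [mul_assoc, trace_mul_comm]
  exact (hQ.mul_mul_conjTranspose_same B).trace_nonneg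

theorem trace_mul_le_trace_mul {P Q Q' : Matrix ι ι ℝ} (hP : P.PosSemidef) (hQ : Q ≤ Q') :
    (P * Q).trace ≤ (P * Q').trace := by
  have := trace_mul_nonneg hP (Matrix.le_iff.1 hQ)
  rw [mul_sub, trace_sub] at this
  linarith

theorem trace_mul_pow_comm (A B : Matrix ι ι ℝ) (m : ℕ) :
    ((A * B) ^ m).trace = ((B * A) ^ m).trace := by
  cases m with
  | zero => simp
  | succ m =>
    rw [pow_succ', mul_assoc, trace_mul_comm, mul_assoc, mul_pow_mul, ← mul_assoc,
      ← pow_succ']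

/-- The two inequalities feed each other. For the first at `k + 1`, apply it at `k` to `X ^ 2`,
rearrange cyclically into powers of `(Xᴴ X)(X Xᴴ)`, separate the factors by the second, and use `2
tr(ST) ≤ tr S² + tr T²`, where both squares have equal trace. For the second at `k + 1`, apply the
first to `P Q` and the second to `Q ^ 2`, `P ^ 2`. -/
theorem trace_pow_two_pow_le_aux (k : ℕ) :
    (∀ X : Matrix ι ι ℝ, (X ^ 2 ^ (k + 1)).trace ≤ ((X * Xᴴ) ^ 2 ^ k).trace) ∧
    ∀ P Q : Matrix ι ι ℝ, P.IsHermitian → Q.IsHermitian →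
      ((P * Q) ^ 2 ^ k).trace ≤ (P ^ 2 ^ k * Q ^ 2 ^ k).trace := by
  induction k with
  | zero =>
    refine ⟨fun X => ?_, fun P Q _ _ => by simp⟩
    have := two_mul_trace_mul_le X X
    simp only [zero_add, pow_one, pow_zero, sq]
    linarith
  | succ k ih =>
    obtain ⟨ihF, ihG⟩ := ih
    constructor
    · intro X
      have hH : ∀ m, (((X * Xᴴ) ^ m)ᴴ = (X * Xᴴ) ^ m) := fun m =>
        ((isHermitian_mul_conjTranspose_self X).pow m)
      have hH' : ∀ m, (((Xᴴ * X) ^ m)ᴴ = (Xᴴ * X) ^ m) := fun m =>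
        ((isHermitian_conjTranspose_mul_self X).pow m)
      have h1 := ihF (X ^ 2)
      have h2 := ihG (Xᴴ * X) (X * Xᴴ) (isHermitian_conjTranspose_mul_self X)
        (isHermitian_mul_conjTranspose_self X)
      have h3 := two_mul_trace_mul_le ((Xᴴ * X) ^ 2 ^ k) ((X * Xᴴ) ^ 2 ^ k)
      rw [hH, hH', ← pow_add, ← pow_add, ← two_mul, ← pow_succ', trace_mul_pow_comm Xᴴ X] at h3
      have h4 : ((X ^ 2 * (X ^ 2)ᴴ) ^ 2 ^ k).trace = ((Xᴴ * X * (X * Xᴴ)) ^ 2 ^ k).trace := by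
        rw [conjTranspose_pow, sq, sq, show X * X * (Xᴴ * Xᴴ) = (X * (X * Xᴴ)) * Xᴴ by
          simp only [mul_assoc], trace_mul_pow_comm]
        simp only [mul_assoc]
      rw [← pow_mul, ← pow_succ'] at h1
      linarith
    · intro P Q hP hQ
      have h1 := ihF (P * Q)
      have h2 := ihG (Q ^ 2) (P ^ 2) (hQ.pow 2) (hP.pow 2)
      have h3 : ((P * Q * (P * Q)ᴴ) ^ 2 ^ k).trace = ((Q ^ 2 * P ^ 2) ^ 2 ^ k).trace := by
        rw [conjTranspose_mul, hP.eq, hQ.eq, mul_assoc, trace_mul_pow_comm]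
        simp only [sq, mul_assoc]
      rw [← pow_mul, ← pow_mul, ← pow_succ', trace_mul_comm] at h2
      linarith

/-- The **Golden–Thompson inequality** for real symmetric matrices. -/
theorem trace_exp_add_le [Nonempty ι] {A B : Matrix ι ι ℝ} (hA : A.IsHermitian)
    (hB : B.IsHermitian) : (exp (A + B)).trace ≤ (exp A * exp B).trace := by
  -- The trace inequality is known only for exponents `2 ^ k`, so the Lie product limit is taken
  -- along that subsequence.
  have hlim := (tendsto_exp_mul_exp_pow A B).comp
    (tendsto_pow_atTop_atTop_of_one_lt (one_lt_two (α := ℕ)))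
  have hc : Continuous fun M : Matrix ι ι ℝ => M.trace := continuous_id.matrix_trace
  refine le_of_tendsto' ((hc.tendsto _).comp hlim) fun k => ?_
  have hs : ∀ {M : Matrix ι ι ℝ}, M.IsHermitian →
      (exp ((((2 ^ k : ℕ) : ℝ))⁻¹ • M)).IsHermitian := fun {M} hM =>
    IsHermitian.exp (by rw [IsHermitian, conjTranspose_smul, hM.eq, star_trivial])
  have he : ∀ M : Matrix ι ι ℝ, exp ((((2 ^ k : ℕ) : ℝ))⁻¹ • M) ^ 2 ^ k = exp M := fun M => by
    rw [← Matrix.exp_nsmul, ← Nat.cast_smul_eq_nsmul ℝ, smul_smul, mul_inv_cancel₀ (by positivity),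
      one_smul]
  have := (trace_pow_two_pow_le_aux k).2 _ _ (hs hA) (hs hB)
  rwa [he, he] at this

theorem exp_le_one_add_add_sq [Nonempty ι] {Δ : Matrix ι ι ℝ} (hΔ : Δ.IsHermitian)
    (h : ‖Δ‖ ≤ 1) : exp Δ ≤ 1 + Δ + Δ ^ 2 := by
  have hsa : IsSelfAdjoint Δ := hΔ
  have h2 : cfc (fun x : ℝ => 1 + x + x ^ 2) Δ = 1 + Δ + Δ ^ 2 := by
    rw [cfc_add (a := Δ) (fun x : ℝ => 1 + x) (fun x => x ^ 2),
      cfc_add (a := Δ) (fun _ : ℝ => 1) (fun x => x), cfc_pow_id Δ 2, cfc_const_one ℝ Δ,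
      cfc_id' ℝ Δ]
  rw [← CFC.real_exp_eq_normedSpace_exp hsa, ← h2]
  refine cfc_mono (fun x hx => ?_)
  have hx1 : |x| ≤ 1 := (spectrum.norm_le_norm_of_mem hx).trans h
  have := (abs_le.1 (Real.abs_exp_sub_one_sub_id_le hx1)).2
  linarith

theorem sq_le_smul_self [Nonempty ι] {A : Matrix ι ι ℝ} (hA : A.PosSemidef) {R : ℝ}
    (h : ‖A‖ ≤ R) : A ^ 2 ≤ R • A := by
  have hsa : IsSelfAdjoint A := hA.1
  rw [← cfc_pow_id (R := ℝ) A 2, ← cfc_const_mul_id (R := ℝ) R A]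
  refine cfc_mono (fun x hx => ?_)
  have hx0 : 0 ≤ x := spectrum_nonneg_of_nonneg hA.nonneg hx
  have hx1 : |x| ≤ R := (spectrum.norm_le_norm_of_mem hx).trans h
  rw [sq]
  exact mul_le_mul_of_nonneg_right ((le_abs_self x).trans hx1) hx0

theorem trace_exp_eq_sum {A : Matrix ι ι ℝ} (hA : A.IsHermitian) :
    (exp A).trace = ∑ i, Real.exp (hA.eigenvalues i) := by
  rw [← CFC.real_exp_eq_normedSpace_exp (show IsSelfAdjoint A from hA), hA.cfc_eq,
    IsHermitian.cfc, Unitary.conjStarAlgAut_apply, trace_mul_comm, ← mul_assoc]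
  simp [trace]

theorem norm_eq_norm_eigenvalues {A : Matrix ι ι ℝ} (hA : A.IsHermitian) :
    ‖A‖ = ‖hA.eigenvalues‖ := by
  conv_lhs => rw [hA.spectral_theorem, Unitary.conjStarAlgAut_apply]
  rw [← Unitary.coe_star, CStarRing.norm_mul_coe_unitary, CStarRing.norm_coe_unitary_mul,
    l2_opNorm_diagonal]
  rfl

theorem trace_exp_le {A : Matrix ι ι ℝ} (hA : A.IsHermitian) :
    (exp A).trace ≤ Fintype.card ι * Real.exp ‖A‖ := by
  rw [trace_exp_eq_sum hA, norm_eq_norm_eigenvalues hA]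
  refine (Finset.sum_le_card_nsmul _ _ (Real.exp ‖hA.eigenvalues‖) fun i _ => ?_).trans_eq
    (by simp)
  exact Real.exp_le_exp.2 ((le_abs_self _).trans (norm_le_pi_norm hA.eigenvalues i))

/-- Positivity makes the norm an eigenvalue, and the other terms of the trace are positive. -/
theorem exp_norm_le_trace_exp [Nonempty ι] {A : Matrix ι ι ℝ} (hA : A.PosSemidef) :
    Real.exp ‖A‖ ≤ (exp A).trace := by
  obtain ⟨i, hi⟩ : ∃ i, ‖hA.1.eigenvalues‖ ≤ ‖hA.1.eigenvalues i‖ := by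
    obtain ⟨i, -, hi⟩ := Finset.exists_max_image Finset.univ
      (fun i => ‖hA.1.eigenvalues i‖) Finset.univ_nonempty
    exact ⟨i, (pi_norm_le_iff_of_nonneg (norm_nonneg _)).2 fun j => hi j (Finset.mem_univ j)⟩
  rw [trace_exp_eq_sum hA.1, norm_eq_norm_eigenvalues hA.1]
  rw [Real.norm_of_nonneg (hA.eigenvalues_nonneg i)] at hi
  exact (Real.exp_le_exp.2 hi).trans
    (Finset.single_le_sum (f := fun i => Real.exp (hA.1.eigenvalues i))
      (fun i _ => (Real.exp_pos _).le) (Finset.mem_univ i))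

end Trace

end MatrixBernstein

namespace MatrixBernstein

open Matrix NormedSpace Filter Topology
open scoped MatrixOrder

/-! ### One step of the matrix supermartingale. -/

section Supermartingale

variable {ι α : Type*} [Fintype α]

theorem isHermitian_sum_smul {A : α → Matrix ι ι ℝ} (hA : ∀ j, (A j).PosSemidef) (c : α → ℝ) :
    (∑ j, c j • A j).IsHermitian := by
  simp only [IsHermitian, conjTranspose_sum, conjTranspose_smul, (hA _).1.eq, star_trivial]

variable [Fintype ι] [DecidableEq ι]

theorem trace_mul_sq_nonneg {E N : Matrix ι ι ℝ} (hE : E.PosSemidef) (hN : N.IsHermitian) :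
    0 ≤ (E * N ^ 2).trace := by
  refine trace_mul_nonneg hE ?_
  have := posSemidef_conjTranspose_mul_self N
  rwa [hN.eq, ← sq] at this

/-- This is nonnegativity of a variance. With `S = ∑ |c_j|`, the matrix `B = ∑ c_j A_j` is the
average of `S · sign(c_j) A_j` under the weights `|c_j| / S`, so `tr(E B²)` is at most the average
of `S² tr(E A_j²)`; then `A_j² ≤ R A_j`. The result is linear in the `A_j`, as the drift is. -/
theorem trace_mul_sum_smul_sq_le [Nonempty ι] {A : α → Matrix ι ι ℝ}
    (hA : ∀ j, (A j).PosSemidef) {R : ℝ} (hR : ∀ j, ‖A j‖ ≤ R) {E : Matrix ι ι ℝ}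
    (hE : E.PosSemidef) (c : α → ℝ) :
    (E * (∑ j, c j • A j) ^ 2).trace
      ≤ (∑ j, |c j|) * (R * ∑ j, |c j| * (E * A j).trace) := by
  set S := ∑ j, |c j| with hS
  set B := ∑ j, c j • A j with hB
  have hBH : B.IsHermitian := isHermitian_sum_smul hA c
  have hS0 : 0 ≤ S := Finset.sum_nonneg fun _ _ => abs_nonneg _
  rcases hS0.eq_or_lt with h0 | hpos
  · have hc : ∀ j, c j = 0 := fun j =>
      abs_eq_zero.1 ((Finset.sum_eq_zero_iff_of_nonneg fun _ _ => abs_nonneg _).1 h0.symm j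
        (Finset.mem_univ j))
    simp [hB, hc]
  have hsq : ∑ j, |c j| * (E * A j ^ 2).trace ≤ R * ∑ j, |c j| * (E * A j).trace := by
    rw [Finset.mul_sum]
    refine Finset.sum_le_sum fun j _ => ?_
    have := trace_mul_le_trace_mul hE (sq_le_smul_self (hA j) (hR j))
    rw [mul_smul_comm, trace_smul, smul_eq_mul] at this
    nlinarith [abs_nonneg (c j)]
  set s : α → ℝ := fun j => (SignType.sign (c j) : ℝ) with hs
  have hs1 : ∀ j, |c j| * s j = c j := fun j => abs_mul_sign (c j)
  have hs2 : ∀ j, |c j| * s j ^ 2 = |c j| := fun j => by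
    rw [sq, ← mul_assoc, hs1, self_mul_sign]
  have hN : ∀ j, 0 ≤ (E * ((S * s j) • A j - B) ^ 2).trace := fun j => by
    refine trace_mul_sq_nonneg hE (IsHermitian.sub ?_ hBH)
    rw [IsHermitian, conjTranspose_smul, (hA j).1.eq, star_trivial]
  have hexp : ∀ j, (E * ((S * s j) • A j - B) ^ 2).trace
      = S ^ 2 * s j ^ 2 * (E * A j ^ 2).trace
        - S * s j * ((E * (A j * B)).trace + (E * (B * A j)).trace) + (E * B ^ 2).trace := by
    intro j
    simp only [sq, sub_mul, mul_sub, trace_sub, smul_mul_assoc, mul_smul_comm, trace_smul,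
      smul_eq_mul, mul_assoc]
    ring
  have hsum : 0 ≤ ∑ j, |c j| * (E * ((S * s j) • A j - B) ^ 2).trace :=
    Finset.sum_nonneg fun j _ => mul_nonneg (abs_nonneg _) (hN j)
  have hl : ∑ j, c j * (E * (A j * B)).trace = (E * B ^ 2).trace := by
    conv_rhs => rw [sq, hB, Finset.sum_mul, Finset.mul_sum, trace_sum]
    simp [trace_smul, hB]
  have hr : ∑ j, c j * (E * (B * A j)).trace = (E * B ^ 2).trace := by
    conv_rhs => rw [sq, hB, Finset.mul_sum, Finset.mul_sum, trace_sum]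
    simp [trace_smul, hB]
  have heq : ∑ j, |c j| * (E * ((S * s j) • A j - B) ^ 2).trace
      = S ^ 2 * ∑ j, |c j| * (E * A j ^ 2).trace - S * (E * B ^ 2).trace := by
    have : ∀ j, |c j| * (E * ((S * s j) • A j - B) ^ 2).trace
        = S ^ 2 * (|c j| * (E * A j ^ 2).trace)
          - S * (c j * (E * (A j * B)).trace) - S * (c j * (E * (B * A j)).trace)
          + |c j| * (E * B ^ 2).trace := fun j => by
      rw [hexp]
      linear_combination (S ^ 2 * (E * A j ^ 2).trace) * hs2 j
        - S * ((E * (A j * B)).trace + (E * (B * A j)).trace) * hs1 j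
    simp only [this, Finset.sum_add_distrib, Finset.sum_sub_distrib, ← Finset.mul_sum, hl, hr,
      ← Finset.sum_mul, ← hS]
    ring
  rw [heq] at hsum
  have : S * (E * B ^ 2).trace ≤ S * (S * ∑ j, |c j| * (E * A j ^ 2).trace) := by
    linarith
  exact (le_of_mul_le_mul_left this hpos).trans (by gcongr)

/-- Golden–Thompson separates `H` from the increment, and `exp Δ ≤ 1 + Δ + Δ²` is then averaged. The
bound on `Δ` is asked only at positive weight, since atoms of weight zero may carry meaningless
quotients. -/
theorem sum_mul_trace_exp_add_le [Nonempty ι] {β : Type*} (s : Finset β) (w : β → ℝ)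
    (Δ : β → Matrix ι ι ℝ) {H : Matrix ι ι ℝ} (hH : H.IsHermitian) (hw : ∀ x ∈ s, 0 ≤ w x)
    (hw1 : ∑ x ∈ s, w x = 1) (hΔ : ∀ x, (Δ x).IsHermitian)
    (hΔ1 : ∀ x ∈ s, 0 < w x → ‖Δ x‖ ≤ 1)
    (hsum : ∑ x ∈ s, w x * ((exp H * Δ x).trace + (exp H * Δ x ^ 2).trace) ≤ 0) :
    ∑ x ∈ s, w x * (exp (H + Δ x)).trace ≤ (exp H).trace := by
  have hE : (exp H).PosSemidef :=
    (IsSelfAdjoint.exp_nonneg (show IsSelfAdjoint H from hH)).posSemidef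
  have key : ∀ x ∈ s, w x * (exp (H + Δ x)).trace ≤ w x * (exp H).trace
      + w x * ((exp H * Δ x).trace + (exp H * Δ x ^ 2).trace) := by
    intro x hx
    rcases (hw x hx).eq_or_lt with h0 | hpos
    · simp [← h0]
    rw [← mul_add]
    refine mul_le_mul_of_nonneg_left ?_ hpos.le
    refine (trace_exp_add_le hH (hΔ x)).trans
      ((trace_mul_le_trace_mul hE (exp_le_one_add_add_sq (hΔ x) (hΔ1 x hx hpos))).trans_eq ?_)
    simp only [mul_add, mul_one, trace_add]
    ring
  refine (Finset.sum_le_sum key).trans ?_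
  rw [Finset.sum_add_distrib, ← Finset.sum_mul, hw1]
  linarith

/-- `F` decreases in mean along each random step `u ↦ u + g • c - h • b`, where the increment `c`
is centred and bounded by `D` in `ℓ₁`, and `b` is a nonnegative vector of mean `q` that controls
the mean size of `c`. -/
def StepDecreasing (F : (α → ℝ) → ℝ) (g h D : ℝ) : Prop :=
  ∀ (β : Type) (s : Finset β) (w : β → ℝ) (c b : β → α → ℝ) (q u : α → ℝ),
    (∀ x ∈ s, 0 ≤ w x) → ∑ x ∈ s, w x = 1 →
    (∀ x ∈ s, 0 < w x → ∑ j, |c x j| ≤ D) →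
    (∀ x j, 0 ≤ b x j) → (∀ x, ∑ j, b x j ≤ 1) →
    (∀ j, ∑ x ∈ s, w x * c x j = 0) → (∀ j, ∑ x ∈ s, w x * b x j = q j) →
    (∀ j, ∑ x ∈ s, w x * |c x j| ≤ 2 * D * q j) →
    ∑ x ∈ s, w x * F (fun j => u j + g * c x j - h * b x j) ≤ F u

theorem norm_sum_smul_le {A : α → Matrix ι ι ℝ} {R : ℝ} (hR : ∀ j, ‖A j‖ ≤ R) (c : α → ℝ) :
    ‖∑ j, c j • A j‖ ≤ (∑ j, |c j|) * R := by
  rw [Finset.sum_mul]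
  refine norm_sum_le_of_le _ fun j _ => ?_
  rw [norm_smul, Real.norm_eq_abs]
  gcongr
  exact hR j

/-- Condition `h1` makes every increment have norm at most `1`. Condition `h2` says that the drift
`h` pays for the second-order terms: `4 g² D² R` from the centred part and `2 h² R` from the drift
itself. -/
theorem stepDecreasing_trace_exp [Nonempty ι] {A : α → Matrix ι ι ℝ}
    (hA : ∀ j, (A j).PosSemidef) {R g h D : ℝ} (hR0 : 0 ≤ R) (hR : ∀ j, ‖A j‖ ≤ R) (hg : 0 ≤ g)
    (hh : 0 ≤ h) (hD : 0 ≤ D) (h1 : g * D * R + h * R ≤ 1)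
    (h2 : 4 * g ^ 2 * D ^ 2 * R + 2 * h ^ 2 * R ≤ h) :
    StepDecreasing (fun u => (exp (∑ j, u j • A j)).trace) g h D := by
  intro β s w c b q u hw hw1 hc hb hb1 hwc hwb hwc'
  set H := ∑ j, u j • A j with hH
  have hHH : H.IsHermitian := isHermitian_sum_smul hA u
  have hE : (exp H).PosSemidef :=
    (IsSelfAdjoint.exp_nonneg (show IsSelfAdjoint H from hHH)).posSemidef
  set C : β → Matrix ι ι ℝ := fun x => ∑ j, c x j • A j with hC
  set B : β → Matrix ι ι ℝ := fun x => ∑ j, b x j • A j with hB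
  have hCH : ∀ x, (C x).IsHermitian := fun x => isHermitian_sum_smul hA _
  have hBH : ∀ x, (B x).IsHermitian := fun x => isHermitian_sum_smul hA _
  have hsm : ∀ (r : ℝ) {M : Matrix ι ι ℝ}, M.IsHermitian → (r • M).IsHermitian := fun r M hM => by
    rw [IsHermitian, conjTranspose_smul, hM.eq, star_trivial]
  have hΔ : ∀ x, ∑ j, (u j + g * c x j - h * b x j) • A j = H + (g • C x - h • B x) := by
    intro x
    simp only [hH, hC, hB, Finset.smul_sum, smul_smul, sub_smul, add_smul, Finset.sum_sub_distrib,
      Finset.sum_add_distrib]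
    abel
  simp only [hΔ]
  refine sum_mul_trace_exp_add_le s w _ hHH hw hw1
    (fun x => (hsm g (hCH x)).sub (hsm h (hBH x))) (fun x hx hpos => ?_) ?_
  · have hb' : ∑ j, |b x j| ≤ 1 := by simpa only [abs_of_nonneg (hb x _)] using hb1 x
    refine (norm_sub_le _ _).trans (le_trans ?_ h1)
    rw [norm_smul, norm_smul, Real.norm_of_nonneg hg, Real.norm_of_nonneg hh, mul_assoc]
    gcongr
    · exact (norm_sum_smul_le hR _).trans (by gcongr; exact hc x hx hpos)
    · exact (norm_sum_smul_le hR _).trans (mul_le_of_le_one_left hR0 hb')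
  · set a : α → ℝ := fun j => (exp H * A j).trace with ha
    have ha0 : ∀ j, 0 ≤ a j := fun j => trace_mul_nonneg hE (hA j)
    have hCt : ∀ x, (exp H * C x).trace = ∑ j, c x j * a j := fun x => by
      simp [hC, ha, Finset.mul_sum, trace_sum]
    have hBt : ∀ x, (exp H * B x).trace = ∑ j, b x j * a j := fun x => by
      simp [hB, ha, Finset.mul_sum, trace_sum]
    have key : ∀ x ∈ s, w x * ((exp H * (g • C x - h • B x)).trace
        + (exp H * (g • C x - h • B x) ^ 2).trace)
        ≤ g * ∑ j, (w x * c x j) * a j - h * ∑ j, (w x * b x j) * a j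
          + 2 * g ^ 2 * (D * R) * ∑ j, (w x * |c x j|) * a j
          + 2 * h ^ 2 * R * ∑ j, (w x * b x j) * a j := by
      intro x hx
      rcases (hw x hx).eq_or_lt with h0 | hpos
      · simp [← h0]
      have e1 : (exp H * (g • C x - h • B x)).trace
          = g * ∑ j, c x j * a j - h * ∑ j, b x j * a j := by
        rw [mul_sub, trace_sub, mul_smul_comm, mul_smul_comm, trace_smul, trace_smul, hCt, hBt,
          smul_eq_mul, smul_eq_mul]
      -- Parallelogram identity: the square of `g C + h B` has nonnegative trace against `exp H`.
      have e2 : (exp H * (g • C x - h • B x) ^ 2).trace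
          ≤ 2 * g ^ 2 * (exp H * C x ^ 2).trace + 2 * h ^ 2 * (exp H * B x ^ 2).trace := by
        have := trace_mul_sq_nonneg hE ((hsm g (hCH x)).add (hsm h (hBH x)))
        simp only [sq, sub_mul, mul_sub, add_mul, mul_add, trace_sub, trace_add, smul_mul_assoc,
          mul_smul_comm, trace_smul, smul_eq_mul] at this ⊢
        linarith
      have e3 : (exp H * C x ^ 2).trace ≤ D * R * ∑ j, |c x j| * a j := by
        refine (trace_mul_sum_smul_sq_le hA hR hE (c x)).trans ?_
        rw [← mul_assoc]
        have : 0 ≤ ∑ j, |c x j| * a j :=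
          Finset.sum_nonneg fun j _ => mul_nonneg (abs_nonneg _) (ha0 j)
        gcongr
        exact hc x hx hpos
      have e4 : (exp H * B x ^ 2).trace ≤ R * ∑ j, b x j * a j := by
        refine (trace_mul_sum_smul_sq_le hA hR hE (b x)).trans ?_
        simp only [abs_of_nonneg (hb x _)]
        have : 0 ≤ ∑ j, b x j * a j :=
          Finset.sum_nonneg fun j _ => mul_nonneg (hb x j) (ha0 j)
        exact mul_le_of_le_one_left (by positivity) (hb1 x)
      have e5 : (exp H * (g • C x - h • B x)).trace + (exp H * (g • C x - h • B x) ^ 2).trace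
          ≤ g * ∑ j, c x j * a j - h * ∑ j, b x j * a j
            + 2 * g ^ 2 * (D * R) * ∑ j, |c x j| * a j + 2 * h ^ 2 * R * ∑ j, b x j * a j := by
        have f1 := mul_le_mul_of_nonneg_left e3 (show 0 ≤ 2 * g ^ 2 by positivity)
        have f2 := mul_le_mul_of_nonneg_left e4 (show 0 ≤ 2 * h ^ 2 by positivity)
        rw [e1]
        linarith
      refine (mul_le_mul_of_nonneg_left e5 hpos.le).trans_eq ?_
      simp only [mul_assoc (w x), ← Finset.mul_sum]
      ring
    refine (Finset.sum_le_sum key).trans ?_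
    have swap : ∀ f : β → α → ℝ, ∑ x ∈ s, ∑ j, f x j * a j = ∑ j, (∑ x ∈ s, f x j) * a j :=
      fun f => by rw [Finset.sum_comm]; simp only [Finset.sum_mul]
    simp only [Finset.sum_add_distrib, Finset.sum_sub_distrib, ← Finset.mul_sum, swap, hwc, hwb]
    have hqa : 0 ≤ ∑ j, q j * a j := Finset.sum_nonneg fun j _ => by
      refine mul_nonneg ?_ (ha0 j)
      rw [← hwb]
      exact Finset.sum_nonneg fun x hx => mul_nonneg (hw x hx) (hb x j)
    have hle : ∑ j, (∑ x ∈ s, w x * |c x j|) * a j ≤ 2 * D * ∑ j, q j * a j := by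
      rw [Finset.mul_sum]
      refine Finset.sum_le_sum fun j _ => ?_
      rw [← mul_assoc]
      exact mul_le_mul_of_nonneg_right (hwc' j) (ha0 j)
    have f1 := mul_le_mul_of_nonneg_left hle (show 0 ≤ 2 * g ^ 2 * (D * R) by positivity)
    have f2 := mul_le_mul_of_nonneg_right h2 hqa
    simp only [zero_mul, mul_zero]
    linarith

end Supermartingale

end MatrixBernstein

namespace MatrixBernstein

section Moments

/-! ### One step of the revealing process, in terms of moments -/

variable {n : ℕ} {F : (Fin n → ℝ) → ℝ} {g h D : ℝ}

/-- Revealing a uniformly chosen coordinate among those in `T`; `m` and `m₂` are the first and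
second moments of a measure of total mass `M` on the cube. -/
theorem StepDecreasing.sum_reveal_coordinate_le (hF : StepDecreasing F g h D)
    {M : ℝ} {m : Fin n → ℝ} {m₂ : Fin n → Fin n → ℝ} (hM : 0 < M) (hm : ∀ i, 0 ≤ m i)
    (hmM : ∀ i, m i ≤ M) (hsymm : ∀ i j, m₂ i j = m₂ j i)
    {T : Finset (Fin n)} (hT : T.Nonempty) (hD : 0 ≤ D)
    (hK : ∀ i, ∑ j, |m₂ i j - m i * m j / M| ≤ D * (m i * (M - m i) / M))
    (hK0 : ∀ i, ∀ j ∉ T, m₂ i j - m i * m j / M = 0) (z : Fin n → ℝ) :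
    ∑ i ∈ T, (m i * F (fun j => g * (m₂ i j / m i) - h * (z j + if i = j then 1 else 0))
        + (M - m i) * F (fun j => g * ((m j - m₂ i j) / (M - m i)) - h * z j))
      ≤ T.card * M * F (fun j => g * (m j / M) - h * z j) := by
  have hcard : (0 : ℝ) < T.card := by exact_mod_cast hT.card_pos
  have hMm : ∀ i, 0 ≤ M - m i := fun i => sub_nonneg.2 (hmM i)
  have hK1 : ∀ i, ∑ j, |m₂ i j - m i * m j / M| ≤ D * m i := fun i => by
    refine (hK i).trans (mul_le_mul_of_nonneg_left ?_ hD)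
    rw [div_le_iff₀ hM]
    exact mul_le_mul_of_nonneg_left (by linarith [hm i]) (hm i)
  -- The factor `m i (M - m i) / M` is at most each of `m i` and `M - m i`, so the increment has
  -- `ℓ₁` norm at most `D` whichever value is revealed.
  have hK2 : ∀ i, ∑ j, |m₂ i j - m i * m j / M| ≤ D * (M - m i) := fun i => by
    refine (hK i).trans (mul_le_mul_of_nonneg_left ?_ hD)
    rw [div_le_iff₀ hM, mul_comm]
    exact mul_le_mul_of_nonneg_left (hmM i) (hMm i)
  have hKi : ∀ i j, |m₂ i j - m i * m j / M| ≤ D * m i := fun i j =>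
    (Finset.single_le_sum (f := fun j => |m₂ i j - m i * m j / M|)
      (fun _ _ => abs_nonneg _) (Finset.mem_univ j)).trans (hK1 i)
  have hKi' : ∀ i j, |m₂ i j - m i * m j / M| ≤ D * (M - m i) := fun i j =>
    (Finset.single_le_sum (f := fun j => |m₂ i j - m i * m j / M|)
      (fun _ _ => abs_nonneg _) (Finset.mem_univ j)).trans (hK2 i)
  set K : Fin n → Fin n → ℝ := fun i j => m₂ i j - m i * m j / M with hKdef
  -- Where `m i = 0` the quotient is a default value, but `K i j` vanishes too.
  have c1 : ∀ i j, m i * (m₂ i j / m i - m j / M) = K i j := fun i j => by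
    rcases (hm i).eq_or_lt with h0 | hpos
    · have hz : K i j = 0 := abs_nonpos_iff.1 ((hKi i j).trans_eq (by rw [← h0, mul_zero]))
      rw [← h0, zero_mul, hz]
    · simp only [hKdef]; field_simp
  have c0 : ∀ i j, (M - m i) * ((m j - m₂ i j) / (M - m i) - m j / M) = - K i j := fun i j => by
    rcases (hMm i).eq_or_lt with h0 | hpos
    · have hz : K i j = 0 := abs_nonpos_iff.1 ((hKi' i j).trans_eq (by rw [← h0, mul_zero]))
      rw [← h0, zero_mul, hz, neg_zero]
    · simp only [hKdef]; field_simp; ring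
  -- The atom `(i, a)` stands for drawing `i` uniformly from `T` and finding a one (`a = true`) or a
  -- zero; `c` is the change in the conditional means and `b` marks a newly found one.
  let w : Fin n × Bool → ℝ := fun p => (if p.2 then m p.1 else M - m p.1) / (T.card * M)
  let c : Fin n × Bool → Fin n → ℝ := fun p j =>
    if p.2 then m₂ p.1 j / m p.1 - m j / M else (m j - m₂ p.1 j) / (M - m p.1) - m j / M
  let b : Fin n × Bool → Fin n → ℝ := fun p j => if p.2 ∧ p.1 = j then 1 else 0
  let q : Fin n → ℝ := fun j => if j ∈ T then m j / (T.card * M) else 0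
  have hsum : ∀ f : Fin n × Bool → ℝ, ∑ p ∈ T ×ˢ (Finset.univ : Finset Bool), f p
      = ∑ i ∈ T, (f (i, true) + f (i, false)) := fun f => by
    rw [Finset.sum_product]; simp
  have hpos : 0 < T.card * M := mul_pos hcard hM
  have := hF (Fin n × Bool) (T ×ˢ Finset.univ) w c b q (fun j => g * (m j / M) - h * z j)
    ?_ ?_ ?_ ?_ ?_ ?_ ?_ ?_
  · rw [hsum] at this
    have e := mul_le_mul_of_nonneg_left this hpos.le
    refine le_trans (le_of_eq ?_) e
    rw [Finset.mul_sum]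
    refine Finset.sum_congr rfl fun i _ => ?_
    have e1 : (fun j => g * (m₂ i j / m i) - h * (z j + if i = j then 1 else 0))
        = fun j => g * (m j / M) - h * z j + g * c (i, true) j - h * b (i, true) j := by
      funext j; simp only [c, b, true_and, if_true]; ring
    have e0 : (fun j => g * ((m j - m₂ i j) / (M - m i)) - h * z j)
        = fun j => g * (m j / M) - h * z j + g * c (i, false) j - h * b (i, false) j := by
      funext j; simp [c, b]; ring
    rw [e1, e0]
    simp only [w, if_true, Bool.false_eq_true, if_false]
    field_simp
  · rintro ⟨i, a⟩ -
    refine div_nonneg ?_ hpos.le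
    split_ifs
    exacts [hm i, hMm i]
  · rw [hsum]
    simp only [w, if_true, Bool.false_eq_true, if_false, ← add_div, add_sub_cancel]
    rw [Finset.sum_const, nsmul_eq_mul]
    field_simp
  · rintro ⟨i, a⟩ - hw
    replace hw := (div_pos_iff_of_pos_right hpos).1 hw
    cases a
    · simp only [Bool.false_eq_true, if_false] at hw
      have : ∀ j, |c (i, false) j| = |K i j| / (M - m i) := fun j => by
        have e := congrArg abs (c0 i j)
        rw [abs_mul, abs_neg, abs_of_pos hw] at e
        rw [eq_div_iff hw.ne', mul_comm, ← e]
        simp [c]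
      simp only [this, ← Finset.sum_div]
      rw [div_le_iff₀ hw]
      exact hK2 i
    · simp only [if_true] at hw
      have : ∀ j, |c (i, true) j| = |K i j| / m i := fun j => by
        have e := congrArg abs (c1 i j)
        rw [abs_mul, abs_of_pos hw] at e
        rw [eq_div_iff hw.ne', mul_comm, ← e]
        simp [c]
      simp only [this, ← Finset.sum_div]
      rw [div_le_iff₀ hw]
      exact hK1 i
  · intro p j
    simp only [b]; split_ifs <;> norm_num
  · rintro ⟨i, a⟩
    cases a <;> simp [b]
  · intro j
    rw [hsum]
    refine Finset.sum_eq_zero fun i _ => ?_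
    have e1 := c1 i j
    have e0 := c0 i j
    simp only [w, c, if_true, Bool.false_eq_true, if_false]
    rw [div_mul_eq_mul_div, div_mul_eq_mul_div, ← add_div, e1, e0]
    simp
  · intro j
    rw [hsum]
    simp [w, b, q]
  · intro j
    rw [hsum]
    -- Both outcomes contribute `|K i j|`, whence the factor `2` in `StepDecreasing`.
    have e : ∀ i, w (i, true) * |c (i, true) j| + w (i, false) * |c (i, false) j|
        = 2 * |K i j| / (T.card * M) := fun i => by
      have e1 := congrArg abs (c1 i j)
      have e0 := congrArg abs (c0 i j)
      rw [abs_mul, abs_of_nonneg (hm i)] at e1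
      rw [abs_mul, abs_neg, abs_of_nonneg (hMm i)] at e0
      simp only [w, c, if_true, Bool.false_eq_true, if_false]
      rw [div_mul_eq_mul_div, div_mul_eq_mul_div, ← add_div, e1, e0]
      ring
    simp only [e, ← Finset.sum_div, ← Finset.mul_sum, q]
    by_cases hj : j ∈ T
    · rw [if_pos hj, mul_div_assoc', div_le_div_iff_of_pos_right hpos, mul_assoc]
      refine mul_le_mul_of_nonneg_left ?_ zero_le_two
      refine le_trans ?_ (hK1 j)
      -- By symmetry the column sum over the random index `i` is part of row `j`; this is why `i` is
      -- drawn at random.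
      have : ∀ i, |K i j| = |m₂ j i - m j * m i / M| := fun i => by
        simp only [hKdef, hsymm i j, mul_comm (m i)]
      simp only [this]
      exact Finset.sum_le_univ_sum_of_nonneg fun _ => abs_nonneg _
    · rw [if_neg hj]
      have : ∀ i, K i j = 0 := fun i => hK0 i j hj
      simp [this]

/-- Revealing one of the coordinates in `T` that are equal to `1`, of which there are `r`. -/
theorem StepDecreasing.sum_reveal_one_le (hF : StepDecreasing F g h D)
    {M r : ℝ} {m : Fin n → ℝ} {m₂ : Fin n → Fin n → ℝ} (hM : 0 < M) (hr : 0 < r)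
    (hm : ∀ i, 0 ≤ m i) (hsymm : ∀ i j, m₂ i j = m₂ j i)
    {T : Finset (Fin n)} (hD : 0 ≤ D) (hrm : ∑ i ∈ T, m i = r * M)
    (hrm₂ : ∀ j, ∑ i ∈ T, m₂ i j = r * m j)
    (hK : ∀ i, ∑ j, |m₂ i j - m i * m j / M| ≤ D * m i)
    (hK0 : ∀ i, ∀ j ∉ T, m₂ i j - m i * m j / M = 0) (z : Fin n → ℝ) :
    ∑ i ∈ T, m i * F (fun j => g * (m₂ i j / m i) - h * (z j + if i = j then 1 else 0))
      ≤ r * M * F (fun j => g * (m j / M) - h * z j) := by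
  have hKi : ∀ i j, |m₂ i j - m i * m j / M| ≤ D * m i := fun i j =>
    (Finset.single_le_sum (f := fun j => |m₂ i j - m i * m j / M|)
      (fun _ _ => abs_nonneg _) (Finset.mem_univ j)).trans (hK i)
  set K : Fin n → Fin n → ℝ := fun i j => m₂ i j - m i * m j / M with hKdef
  have hpos : 0 < r * M := mul_pos hr hM
  let c : Fin n → Fin n → ℝ := fun i j => m₂ i j / m i - m j / M
  have c1 : ∀ i j, m i * c i j = K i j := fun i j => by
    rcases (hm i).eq_or_lt with h0 | hpos
    · have hz : K i j = 0 := abs_nonpos_iff.1 ((hKi i j).trans_eq (by rw [← h0, mul_zero]))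
      rw [← h0, zero_mul, hz]
    · simp only [hKdef, c]; field_simp
  let w : Fin n → ℝ := fun i => m i / (r * M)
  let b : Fin n → Fin n → ℝ := fun i j => if i = j then 1 else 0
  let q : Fin n → ℝ := fun j => if j ∈ T then m j / (r * M) else 0
  have := hF (Fin n) T w c b q (fun j => g * (m j / M) - h * z j) ?_ ?_ ?_ ?_ ?_ ?_ ?_ ?_
  · have e := mul_le_mul_of_nonneg_left this hpos.le
    refine le_trans (le_of_eq ?_) e
    rw [Finset.mul_sum]
    refine Finset.sum_congr rfl fun i _ => ?_
    have e1 : (fun j => g * (m₂ i j / m i) - h * (z j + if i = j then 1 else 0))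
        = fun j => g * (m j / M) - h * z j + g * c i j - h * b i j := by
      funext j; simp only [c, b]; ring
    rw [e1]
    simp only [w]
    field_simp
  · exact fun i _ => div_nonneg (hm i) hpos.le
  · rw [← Finset.sum_div, hrm, div_self hpos.ne']
  · intro i _ hw
    replace hw := (div_pos_iff_of_pos_right hpos).1 hw
    have : ∀ j, |c i j| = |K i j| / m i := fun j => by
      have e := congrArg abs (c1 i j)
      rw [abs_mul, abs_of_pos hw] at e
      rw [eq_div_iff hw.ne', mul_comm, ← e]
    simp only [this, ← Finset.sum_div]
    rw [div_le_iff₀ hw]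
    exact hK i
  · intro p j
    simp only [b]; split_ifs <;> norm_num
  · intro i
    simp [b]
  · intro j
    -- Centring rests on the fixed number `r` of ones in `T`, through `hrm` and `hrm₂`.
    simp only [w, div_mul_eq_mul_div, c1, ← Finset.sum_div, hKdef, Finset.sum_sub_distrib, hrm₂,
      ← Finset.sum_mul, hrm]
    field_simp
    simp
  · intro j
    simp [w, b, q]
  · intro j
    have e : ∀ i, w i * |c i j| = |K i j| / (r * M) := fun i => by
      rw [← c1, abs_mul, abs_of_nonneg (hm i)]
      simp only [w]
      ring
    simp only [e, ← Finset.sum_div, q]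
    by_cases hj : j ∈ T
    · rw [if_pos hj, mul_div_assoc', div_le_div_iff_of_pos_right hpos]
      have : ∀ i, |K i j| = |m₂ j i - m j * m i / M| := fun i => by
        simp only [hKdef, hsymm i j, mul_comm (m i)]
      simp only [this]
      refine (Finset.sum_le_univ_sum_of_nonneg fun _ => abs_nonneg _).trans ((hK j).trans ?_)
      nlinarith [mul_nonneg hD (hm j)]
    · rw [if_neg hj]
      have : ∀ i, K i j = 0 := fun i => hK0 i j hj
      simp [this]

end Moments

end MatrixBernstein

namespace MatrixBernstein

/-! ### Weights on the cube -/

section Weights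

variable {n : ℕ}

/-- The coordinate `x_j`, as a real number. -/
def bit (x : Cube n) (j : Fin n) : ℝ := ((x j : ℕ) : ℝ)

/-- The total mass of a weight on the cube. -/
def mass (v : Cube n → ℝ) : ℝ := ∑ x, v x

/-- The first moments of a weight on the cube. -/
def first (v : Cube n → ℝ) (i : Fin n) : ℝ := ∑ x, v x * bit x i

/-- The second moments of a weight on the cube. -/
def second (v : Cube n → ℝ) (i j : Fin n) : ℝ := ∑ x, v x * bit x i * bit x j

/-- The covariances of a weight on the cube, multiplied by the total mass. -/
noncomputable def scaledCov (v : Cube n → ℝ) (i j : Fin n) : ℝ := second v i j - first v i * first v j / mass v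

/-- The restriction of a weight to the points that agree with `σ` on `Λ`. -/
def pin (w : Cube n → ℝ) (Λ : Finset (Fin n)) (σ x : Cube n) : ℝ :=
  if ∀ l ∈ Λ, x l = σ l then w x else 0

theorem fin_two_eq (a : Fin 2) : a = 0 ∨ a = 1 := by omega

theorem bit_eq_one_iff {x : Cube n} {j : Fin n} : bit x j = 1 ↔ x j = 1 := by
  rcases fin_two_eq (x j) with h | h <;> simp [bit, h]

theorem bit_eq_zero_iff {x : Cube n} {j : Fin n} : bit x j = 0 ↔ x j = 0 := by
  rcases fin_two_eq (x j) with h | h <;> simp [bit, h]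

theorem bit_eq_zero_or_one (x : Cube n) (j : Fin n) : bit x j = 0 ∨ bit x j = 1 := by
  rw [bit_eq_zero_iff, bit_eq_one_iff]; exact fin_two_eq _

theorem bit_nonneg (x : Cube n) (j : Fin n) : 0 ≤ bit x j := Nat.cast_nonneg _

theorem bit_le_one (x : Cube n) (j : Fin n) : bit x j ≤ 1 := by
  rcases bit_eq_zero_or_one x j with h | h <;> norm_num [h]

theorem bit_mul_self (x : Cube n) (j : Fin n) : bit x j * bit x j = bit x j := by
  rcases bit_eq_zero_or_one x j with h | h <;> simp [h]

theorem eq_of_bit_eq {x y : Cube n} (h : ∀ j, bit x j = bit y j) : x = y := by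
  funext j
  have := h j
  simp only [bit, Nat.cast_inj] at this
  exact Fin.ext this

variable {v w : Cube n → ℝ}

theorem mass_nonneg (hv : ∀ x, 0 ≤ v x) : 0 ≤ mass v := Finset.sum_nonneg fun x _ => hv x

theorem eq_zero_of_mass_eq_zero (hv : ∀ x, 0 ≤ v x) (h : mass v = 0) (x : Cube n) : v x = 0 :=
  (Finset.sum_eq_zero_iff_of_nonneg fun x _ => hv x).1 h x (Finset.mem_univ x)

theorem first_nonneg (hv : ∀ x, 0 ≤ v x) (i : Fin n) : 0 ≤ first v i :=
  Finset.sum_nonneg fun x _ => mul_nonneg (hv x) (bit_nonneg x i)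

theorem first_le_mass (hv : ∀ x, 0 ≤ v x) (i : Fin n) : first v i ≤ mass v :=
  Finset.sum_le_sum fun x _ => mul_le_of_le_one_right (hv x) (bit_le_one x i)

theorem second_comm (v : Cube n → ℝ) (i j : Fin n) : second v i j = second v j i := by
  simp only [second, mul_right_comm]

theorem second_self (v : Cube n → ℝ) (i : Fin n) : second v i i = first v i := by
  simp only [second, first, mul_assoc, bit_mul_self]

theorem mass_mul_bit (v : Cube n → ℝ) (i : Fin n) : mass (fun x => v x * bit x i) = first v i := rfl

theorem first_mul_bit (v : Cube n → ℝ) (i j : Fin n) :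
    first (fun x => v x * bit x i) j = second v i j := rfl

theorem mass_mul_one_sub_bit (v : Cube n → ℝ) (i : Fin n) :
    mass (fun x => v x * (1 - bit x i)) = mass v - first v i := by
  simp only [mass, first, mul_sub, mul_one, Finset.sum_sub_distrib]

theorem first_mul_one_sub_bit (v : Cube n → ℝ) (i j : Fin n) :
    first (fun x => v x * (1 - bit x i)) j = first v j - second v i j := by
  simp only [first, second, mul_sub, sub_mul, mul_one, Finset.sum_sub_distrib]

theorem pin_nonneg (hw : ∀ x, 0 ≤ w x) (Λ : Finset (Fin n)) (σ x : Cube n) : 0 ≤ pin w Λ σ x := by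
  unfold pin; split_ifs
  exacts [hw x, le_rfl]

theorem pin_empty (w : Cube n → ℝ) (σ : Cube n) : pin w ∅ σ = w := by
  funext x; simp [pin]

theorem pin_insert_of_eq_one (w : Cube n → ℝ) {Λ : Finset (Fin n)} {σ : Cube n} {i : Fin n}
    (h : σ i = 1) : pin w (insert i Λ) σ = fun x => pin w Λ σ x * bit x i := by
  funext x
  rcases fin_two_eq (x i) with hx | hx
  · simp [pin, h, hx, bit_eq_zero_iff.2 hx]
  · simp [pin, h, hx, bit_eq_one_iff.2 hx]

theorem pin_insert_of_eq_zero (w : Cube n → ℝ) {Λ : Finset (Fin n)} {σ : Cube n} {i : Fin n}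
    (h : σ i = 0) : pin w (insert i Λ) σ = fun x => pin w Λ σ x * (1 - bit x i) := by
  funext x
  rcases fin_two_eq (x i) with hx | hx
  · simp [pin, h, hx, bit_eq_zero_iff.2 hx]
  · simp [pin, h, hx, bit_eq_one_iff.2 hx]

theorem pin_congr (w : Cube n → ℝ) {Λ : Finset (Fin n)} {σ τ : Cube n}
    (h : ∀ l ∈ Λ, σ l = τ l) : pin w Λ σ = pin w Λ τ := by
  funext x
  have : (∀ l ∈ Λ, x l = σ l) ↔ ∀ l ∈ Λ, x l = τ l :=
    forall₂_congr fun l hl => by rw [h l hl]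
  simp only [pin, this]

theorem agree_of_pin_ne_zero {Λ : Finset (Fin n)} {σ x : Cube n} (h : pin w Λ σ x ≠ 0) :
    ∀ l ∈ Λ, x l = σ l := by
  by_contra hc
  exact h (if_neg hc)

theorem ne_zero_of_pin_ne_zero {Λ : Finset (Fin n)} {σ x : Cube n} (h : pin w Λ σ x ≠ 0) :
    w x ≠ 0 := by
  unfold pin at h
  split_ifs at h
  · exact h
  · exact absurd rfl h

theorem pin_mul_bit (w : Cube n → ℝ) {Λ : Finset (Fin n)} (σ x : Cube n) {j : Fin n} (hj : j ∈ Λ) :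
    pin w Λ σ x * bit x j = pin w Λ σ x * bit σ j := by
  by_cases h : pin w Λ σ x = 0
  · simp [h]
  · rw [bit, agree_of_pin_ne_zero h j hj, bit]

/-- A pinned coordinate is constant on the support, so revealing another one does not move it. -/
theorem scaledCov_pin_eq_zero {Λ : Finset (Fin n)} {σ : Cube n} (h : mass (pin w Λ σ) ≠ 0)
    (i : Fin n) {j : Fin n} (hj : j ∈ Λ) : scaledCov (pin w Λ σ) i j = 0 := by
  have h1 : first (pin w Λ σ) j = mass (pin w Λ σ) * bit σ j := by
    simp only [first, mass, pin_mul_bit w σ _ hj, Finset.sum_mul]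
  have h2 : second (pin w Λ σ) i j = first (pin w Λ σ) i * bit σ j := by
    simp only [second, first, mul_right_comm _ (bit _ i) (bit _ j), pin_mul_bit w σ _ hj,
      Finset.sum_mul]
  rw [scaledCov, h1, h2]
  field_simp
  simp

/-! ### Exponential moments -/

variable {F : (Fin n → ℝ) → ℝ} {g h D : ℝ}

/-- The terminal state of the revealing process: the conditional means are the coordinates
themselves. -/
theorem sum_mul_eq_of_constant {z : Fin n → ℝ} (hz : ∀ x, v x ≠ 0 → ∀ j, bit x j = z j)
    (h0 : mass v ≠ 0) :
    ∑ x, v x * F (fun j => (g - h) * bit x j)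
      = mass v * F (fun j => g * (first v j / mass v) - h * z j) := by
  have hfirst : ∀ j, first v j / mass v = z j := fun j => by
    rw [div_eq_iff h0, mul_comm, first, mass, Finset.sum_mul]
    refine Finset.sum_congr rfl fun x _ => ?_
    by_cases hx : v x = 0
    · simp [hx]
    · rw [hz x hx]
  simp only [hfirst]
  rw [mass, Finset.sum_mul]
  refine Finset.sum_congr rfl fun x _ => ?_
  by_cases hx : v x = 0
  · simp [hx]
  · simp only [hz x hx, sub_mul]

/-- Induction on the number of unpinned coordinates. For each unpinned `i`, splitting by the value
of `x_i` bounds the same left-hand side; summing over `i` and applying the one-step inequality gives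
the claim multiplied by `Λᶜ.card`. -/
theorem StepDecreasing.sum_pin_mul_le_of_twoSided (hF : StepDecreasing F g h D) (hD : 0 ≤ D)
    (hw : ∀ x, 0 ≤ w x)
    (hcov : ∀ Λ σ i, ∑ j, |scaledCov (pin w Λ σ) i j| ≤ D * (first (pin w Λ σ) i *
      (mass (pin w Λ σ) - first (pin w Λ σ) i) / mass (pin w Λ σ))) (m : ℕ) :
    ∀ (Λ : Finset (Fin n)) (σ : Cube n), Λᶜ.card = m →
      ∑ x, pin w Λ σ x * F (fun j => (g - h) * bit x j) ≤ mass (pin w Λ σ) *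
        F (fun j => g * (first (pin w Λ σ) j / mass (pin w Λ σ))
          - h * (if j ∈ Λ then bit σ j else 0)) := by
  induction m with
  | zero =>
    intro Λ σ hΛ
    rcases eq_or_ne (mass (pin w Λ σ)) 0 with h0 | h0
    · simp [h0, eq_zero_of_mass_eq_zero (pin_nonneg hw Λ σ) h0]
    have hmem : ∀ j, j ∈ Λ := fun j => by
      by_contra hj
      have := Finset.card_eq_zero.1 hΛ
      exact Finset.notMem_empty j (this ▸ Finset.mem_compl.2 hj)
    refine (sum_mul_eq_of_constant (fun x hx j => ?_) h0).le
    rw [if_pos (hmem j), bit, agree_of_pin_ne_zero hx j (hmem j), bit]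
  | succ m ih =>
    intro Λ σ hΛ
    set v := pin w Λ σ with hv
    have hv0 : ∀ x, 0 ≤ v x := pin_nonneg hw Λ σ
    rcases (mass_nonneg hv0).eq_or_lt with h0 | hpos
    · simp [← h0, eq_zero_of_mass_eq_zero hv0 h0.symm]
    have hT : Λᶜ.Nonempty := Finset.card_pos.1 (by omega)
    have hstep := hF.sum_reveal_coordinate_le hpos (first_nonneg hv0) (first_le_mass hv0)
      (second_comm v) hT hD (hcov Λ σ)
      (fun i j hj => scaledCov_pin_eq_zero hpos.ne' i (by simpa using hj))
      (fun j => if j ∈ Λ then bit σ j else 0)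
    have hbranch : ∀ i ∈ Λᶜ, ∑ x, v x * F (fun j => (g - h) * bit x j)
        ≤ first v i * F (fun j => g * (second v i j / first v i)
            - h * ((if j ∈ Λ then bit σ j else 0) + if i = j then 1 else 0))
          + (mass v - first v i) * F (fun j => g * ((first v j - second v i j)
            / (mass v - first v i)) - h * (if j ∈ Λ then bit σ j else 0)) := by
      intro i hi
      have hi' : i ∉ Λ := Finset.mem_compl.1 hi
      have hcard : (insert i Λ)ᶜ.card = m := by
        rw [Finset.compl_insert, Finset.card_erase_of_mem hi, hΛ]; rfl
      have hagree : ∀ a : Fin 2, ∀ l ∈ Λ, Function.update σ i a l = σ l := fun a l hl =>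
        Function.update_of_ne (ne_of_mem_of_not_mem hl hi') _ _
      have e1 : pin w (insert i Λ) (Function.update σ i 1) = fun x => v x * bit x i := by
        rw [pin_insert_of_eq_one w (Function.update_self i 1 σ), pin_congr w (hagree 1)]
      have e0 : pin w (insert i Λ) (Function.update σ i 0) = fun x => v x * (1 - bit x i) := by
        rw [pin_insert_of_eq_zero w (Function.update_self i 0 σ), pin_congr w (hagree 0)]
      have i1 := ih (insert i Λ) (Function.update σ i 1) hcard
      have i0 := ih (insert i Λ) (Function.update σ i 0) hcard
      rw [e1, mass_mul_bit] at i1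
      rw [e0, mass_mul_one_sub_bit] at i0
      simp only [first_mul_bit] at i1
      simp only [first_mul_one_sub_bit] at i0
      have z1 : ∀ j, (if j ∈ insert i Λ then bit (Function.update σ i 1) j else 0)
          = (if j ∈ Λ then bit σ j else 0) + if i = j then 1 else 0 := fun j => by
        rcases eq_or_ne i j with rfl | hij
        · simp [hi', bit]
        · simp [bit, hij, hij.symm]
      have z0 : ∀ j, (if j ∈ insert i Λ then bit (Function.update σ i 0) j else 0)
          = if j ∈ Λ then bit σ j else 0 := fun j => by
        rcases eq_or_ne i j with rfl | hij
        · simp [hi', bit]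
        · simp [bit, hij.symm]
      simp only [z1] at i1
      simp only [z0] at i0
      refine le_trans (le_of_eq ?_) (add_le_add i1 i0)
      rw [← Finset.sum_add_distrib]
      refine Finset.sum_congr rfl fun x _ => ?_
      ring
    have := (Finset.sum_le_sum hbranch).trans hstep
    rw [Finset.sum_const, nsmul_eq_mul, mul_assoc] at this
    exact le_of_mul_le_mul_left this (by exact_mod_cast hT.card_pos)

/-- Only ones are pinned. Every point of the support has exactly `r = k - Λ.card` ones outside `Λ`,
so the sum over branches counts the left-hand side `r` times. The process stops at `r = 0`, when all
remaining coordinates are zero. -/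
theorem StepDecreasing.sum_pin_mul_le_of_oneSided (hF : StepDecreasing F g h D) (hD : 0 ≤ D)
    (hw : ∀ x, 0 ≤ w x) {k : ℕ} (hk : ∀ x, w x ≠ 0 → ∑ i, bit x i = k)
    (hcov : ∀ Λ i, ∑ j, |scaledCov (pin w Λ fun _ => 1) i j| ≤ D * first (pin w Λ fun _ => 1) i)
    (m : ℕ) : ∀ Λ : Finset (Fin n), Λᶜ.card = m →
      ∑ x, pin w Λ (fun _ => 1) x * F (fun j => (g - h) * bit x j)
        ≤ mass (pin w Λ fun _ => 1) * F (fun j => g * (first (pin w Λ fun _ => 1) j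
          / mass (pin w Λ fun _ => 1)) - h * (if j ∈ Λ then 1 else 0)) := by
  induction m using Nat.strong_induction_on with
  | _ m ih =>
  intro Λ hΛ
  set v := pin w Λ (fun _ => 1) with hv
  have hv0 : ∀ x, 0 ≤ v x := pin_nonneg hw Λ _
  rcases (mass_nonneg hv0).eq_or_lt with h0 | hpos
  · simp [← h0, eq_zero_of_mass_eq_zero hv0 h0.symm]
  set r : ℝ := k - Λ.card with hr
  have hone : ∀ x, v x ≠ 0 → ∀ j ∈ Λ, bit x j = 1 := fun x hx j hj =>
    bit_eq_one_iff.2 (agree_of_pin_ne_zero hx j hj)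
  have hrest : ∀ x, v x ≠ 0 → ∑ i ∈ Λᶜ, bit x i = r := fun x hx => by
    have h1 := hk x (ne_zero_of_pin_ne_zero hx)
    have h2 : ∑ i ∈ Λ, bit x i = Λ.card := by
      rw [Finset.sum_congr rfl (hone x hx)]; simp
    rw [← Finset.sum_add_sum_compl Λ, h2] at h1
    rw [hr]; linarith
  have hr0 : 0 ≤ r := by
    obtain ⟨x, -, hx⟩ := Finset.exists_ne_zero_of_sum_ne_zero hpos.ne'
    rw [← hrest x hx]
    exact Finset.sum_nonneg fun i _ => bit_nonneg x i
  rcases hr0.eq_or_lt with hr1 | hr1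
  · refine (sum_mul_eq_of_constant (fun x hx j => ?_) hpos.ne').le
    split_ifs with hj
    · exact hone x hx j hj
    · have h1 := hrest x hx
      rw [← hr1] at h1
      exact (Finset.sum_eq_zero_iff_of_nonneg fun i _ => bit_nonneg x i).1 h1 j
        (Finset.mem_compl.2 hj)
  · have hmul : ∀ x, v x * ∑ i ∈ Λᶜ, bit x i = r * v x := fun x => by
      by_cases hx : v x = 0
      · simp [hx]
      · rw [hrest x hx, mul_comm]
    have hstep := hF.sum_reveal_one_le (T := Λᶜ) hpos hr1 (first_nonneg hv0)
      (second_comm v) hD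
      (by
        simp only [first, mass]
        rw [Finset.sum_comm, Finset.mul_sum]
        simp only [← Finset.mul_sum, hmul])
      (fun j => by
        simp only [second, first]
        rw [Finset.sum_comm]
        simp only [← Finset.sum_mul, ← Finset.mul_sum, hmul]
        simp only [mul_assoc, ← Finset.mul_sum])
      (hcov Λ) (fun i j hj => scaledCov_pin_eq_zero hpos.ne' i (by simpa using hj))
      (fun j => if j ∈ Λ then 1 else 0)
    have hbranch : ∀ i ∈ Λᶜ, ∑ x, v x * bit x i * F (fun j => (g - h) * bit x j)
        ≤ first v i * F (fun j => g * (second v i j / first v i)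
            - h * ((if j ∈ Λ then 1 else 0) + if i = j then 1 else 0)) := by
      intro i hi
      have hi' : i ∉ Λ := Finset.mem_compl.1 hi
      have hcard : (insert i Λ)ᶜ.card < m := by
        rw [Finset.compl_insert, ← hΛ]
        exact Finset.card_erase_lt_of_mem hi
      have i1 := ih _ hcard (insert i Λ) rfl
      rw [pin_insert_of_eq_one w rfl, ← hv, mass_mul_bit] at i1
      simp only [first_mul_bit] at i1
      have z1 : ∀ j, (if j ∈ insert i Λ then (1 : ℝ) else 0)
          = (if j ∈ Λ then 1 else 0) + if i = j then 1 else 0 := fun j => by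
        rcases eq_or_ne i j with rfl | hij
        · simp [hi']
        · simp [hij, hij.symm]
      simpa only [z1] using i1
    have := (Finset.sum_le_sum hbranch).trans hstep
    rw [Finset.sum_comm] at this
    simp only [← Finset.sum_mul, ← Finset.mul_sum, hmul] at this
    simp only [mul_assoc, ← Finset.mul_sum] at this
    exact le_of_mul_le_mul_left this hr1

/-! ### Independence with parameter less than one -/

/-- The diagonal covariance equals `first w i (mass w - first w i) / mass w` and is at most `D < 1`
times itself, so every coordinate has variance zero. -/
theorem eq_of_twoSided_lt_one (hD : D < 1) (hw : ∀ x, 0 ≤ w x)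
    (hcov : ∀ i, ∑ j, |scaledCov w i j| ≤ D * (first w i * (mass w - first w i) / mass w))
    {x y : Cube n} (hx : w x ≠ 0) (hy : w y ≠ 0) : x = y := by
  have hpos : 0 < mass w := (hw x).lt_of_ne' hx |>.trans_le
    (Finset.single_le_sum (f := w) (fun x _ => hw x) (Finset.mem_univ x))
  have key : ∀ i, first w i * (mass w - first w i) / mass w = 0 := fun i => by
    have h1 := (Finset.single_le_sum (f := fun j => |scaledCov w i j|)
      (fun _ _ => abs_nonneg _) (Finset.mem_univ i)).trans (hcov i)
    have h2 : scaledCov w i i = first w i * (mass w - first w i) / mass w := by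
      rw [scaledCov, second_self]; field_simp
    have h3 : 0 ≤ first w i * (mass w - first w i) / mass w :=
      div_nonneg (mul_nonneg (first_nonneg hw i) (sub_nonneg.2 (first_le_mass hw i))) hpos.le
    simp only [h2, abs_of_nonneg h3] at h1
    nlinarith
  refine eq_of_bit_eq fun i => ?_
  have h1 : first w i = 0 ∨ mass w - first w i = 0 := by
    have := key i
    rwa [div_eq_zero_iff, or_iff_left hpos.ne', mul_eq_zero] at this
  rcases h1 with h1 | h1
  · have := fun x => eq_zero_of_mass_eq_zero (v := fun x => w x * bit x i)
      (fun x => mul_nonneg (hw x) (bit_nonneg x i)) h1 x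
    rw [(mul_eq_zero.1 (this x)).resolve_left hx, (mul_eq_zero.1 (this y)).resolve_left hy]
  · rw [← mass_mul_one_sub_bit] at h1
    have := fun x => eq_zero_of_mass_eq_zero (v := fun x => w x * (1 - bit x i))
      (fun x => mul_nonneg (hw x) (sub_nonneg.2 (bit_le_one x i))) h1 x
    linarith [(mul_eq_zero.1 (this x)).resolve_left hx, (mul_eq_zero.1 (this y)).resolve_left hy]

/-- Homogeneity makes each covariance row sum to zero, so the diagonal entry is at most half the
row's `ℓ₁` norm. With `p = first v i / mass v` this reads `2 (1 - p) ≤ D < 1`, that is, `p > 1/2`.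
-/
theorem mass_lt_two_mul_first (hD : D < 1) (hv : ∀ x, 0 ≤ v x) {k : ℕ}
    (hk : ∀ x, v x ≠ 0 → ∑ i, bit x i = k) {i : Fin n}
    (hcov : ∑ j, |scaledCov v i j| ≤ D * first v i) (hi : 0 < first v i) :
    mass v < 2 * first v i := by
  have hpos : 0 < mass v := hi.trans_le (first_le_mass hv i)
  have hmul : ∀ x, v x * ∑ i, bit x i = v x * k := fun x => by
    by_cases hx : v x = 0
    · simp [hx]
    · rw [hk x hx]
  have hf : ∑ j, first v j = mass v * k := by
    simp only [first, mass]
    rw [Finset.sum_comm, Finset.sum_mul]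
    simp only [← Finset.mul_sum, hmul]
  have hs : ∑ j, second v i j = first v i * k := by
    simp only [second, first]
    rw [Finset.sum_comm, Finset.sum_mul]
    simp only [mul_right_comm _ (bit _ i), ← Finset.sum_mul, ← Finset.mul_sum, hmul]
  have h0 : ∑ j, scaledCov v i j = 0 := by
    simp only [scaledCov, Finset.sum_sub_distrib, ← Finset.sum_div, ← Finset.mul_sum, hf, hs]
    field_simp
    simp
  have h1 : scaledCov v i i ≤ |scaledCov v i i| := le_abs_self _
  have h2 : scaledCov v i i ≤ ∑ j ∈ Finset.univ.erase i, |scaledCov v i j| := by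
    have : scaledCov v i i = -∑ j ∈ Finset.univ.erase i, scaledCov v i j := by
      rw [← Finset.add_sum_erase _ _ (Finset.mem_univ i)] at h0
      linarith
    rw [this]
    exact (neg_le_abs _).trans (Finset.abs_sum_le_sum_abs _ _)
  rw [← Finset.add_sum_erase _ _ (Finset.mem_univ i)] at hcov
  have h3 : 2 * (first v i - first v i * first v i / mass v) ≤ D * first v i := by
    rw [← second_self v i] at *
    have : scaledCov v i i = second v i i - second v i i * second v i i / mass v := by
      rw [scaledCov, second_self]
    linarith
  have h4 : 2 * (1 - first v i / mass v) < 1 := by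
    have : 2 * (1 - first v i / mass v) * first v i < 1 * first v i := by
      have e : 2 * (1 - first v i / mass v) * first v i
        = 2 * (first v i - first v i * first v i / mass v) := by ring
      rw [e]
      exact h3.trans_lt (mul_lt_mul_of_pos_right hD hi)
    exact lt_of_mul_lt_mul_right this hi.le
  have h5 : 1 / 2 < first v i / mass v := by linarith
  rw [lt_div_iff₀ hpos] at h5
  linarith

/-- Distinct points of the support have equally many ones, so some `i` is a one of `x` only and some
`j` a one of `y` only. Both coordinates are one with conditional probability above `1/2`, so some
`u` in the support has both. Pinning `i` gives `x = u` and pinning `j` gives `y = u`, by induction.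
-/
theorem eq_of_oneSided_lt_one (hD : D < 1) (hw : ∀ x, 0 ≤ w x) {k : ℕ}
    (hk : ∀ x, w x ≠ 0 → ∑ i, bit x i = k)
    (hcov : ∀ Λ i, ∑ j, |scaledCov (pin w Λ fun _ => 1) i j| ≤ D * first (pin w Λ fun _ => 1) i)
    (m : ℕ) : ∀ Λ : Finset (Fin n), Λᶜ.card = m → ∀ x y : Cube n,
      pin w Λ (fun _ => 1) x ≠ 0 → pin w Λ (fun _ => 1) y ≠ 0 → x = y := by
  induction m using Nat.strong_induction_on with
  | _ m ih =>
  intro Λ hΛ x y hx hy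
  set v := pin w Λ (fun _ => 1) with hv
  have hv0 : ∀ x, 0 ≤ v x := pin_nonneg hw Λ _
  by_contra hxy
  have hexists : ∀ x y : Cube n, v x ≠ 0 → v y ≠ 0 → x ≠ y → ∃ i, bit x i = 1 ∧ bit y i = 0 := by
    intro x y hx hy hxy
    by_contra! hc
    have hle : ∀ i ∈ Finset.univ, bit x i ≤ bit y i := fun i _ => by
      rcases bit_eq_zero_or_one x i with h | h
      · rw [h]; exact bit_nonneg y i
      · rw [h, (bit_eq_zero_or_one y i).resolve_left (hc i h)]
    have heq : ∑ i, bit x i = ∑ i, bit y i := by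
      rw [hk x (ne_zero_of_pin_ne_zero hx), hk y (ne_zero_of_pin_ne_zero hy)]
    exact hxy (eq_of_bit_eq fun i => (Finset.sum_eq_sum_iff_of_le hle).1 heq i (Finset.mem_univ i))
  obtain ⟨i, hxi, hyi⟩ := hexists x y hx hy hxy
  obtain ⟨j, hyj, hxj⟩ := hexists y x hy hx (Ne.symm hxy)
  have hpos : ∀ x i, v x ≠ 0 → bit x i = 1 → 0 < first v i := fun x i hx hxi => by
    refine lt_of_lt_of_le ((hv0 x).lt_of_ne' hx) (le_trans (le_of_eq ?_)
      (Finset.single_le_sum (f := fun x => v x * bit x i)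
      (fun x _ => mul_nonneg (hv0 x) (bit_nonneg x i)) (Finset.mem_univ x)))
    simp [hxi]
  have hlt : ∀ i, 0 < first v i → mass v < 2 * first v i := fun i hi =>
    mass_lt_two_mul_first hD hv0 (fun x hx => hk x (ne_zero_of_pin_ne_zero hx)) (hcov Λ i) hi
  have hi := hlt i (hpos x i hx hxi)
  have hj := hlt j (hpos y j hy hyj)
  obtain ⟨u, -, hu⟩ : ∃ u ∈ Finset.univ, 0 < v u * (bit u i + bit u j - 1) := by
    refine Finset.exists_lt_of_sum_lt (f := fun _ => (0 : ℝ)) ?_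
    simp only [mul_sub, mul_add, mul_one, Finset.sum_sub_distrib, Finset.sum_add_distrib,
      Finset.sum_const_zero]
    change 0 < first v i + first v j - mass v
    linarith
  have hvu : v u ≠ 0 := fun h => by simp [h] at hu
  have hu' : 0 < bit u i + bit u j - 1 := (pos_iff_pos_of_mul_pos hu).1 ((hv0 u).lt_of_ne' hvu)
  have hui : bit u i = 1 := (bit_eq_zero_or_one u i).resolve_left fun h => by
    linarith [bit_le_one u j]
  have huj : bit u j = 1 := (bit_eq_zero_or_one u j).resolve_left fun h => by
    linarith [bit_le_one u i]
  have hmerge : ∀ x i, v x ≠ 0 → bit x i = 1 → bit u i = 1 → i ∉ Λ → x = u := by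
    intro x i hx hxi hui hi
    refine ih (insert i Λ)ᶜ.card ?_ (insert i Λ) rfl x u ?_ ?_
    · rw [Finset.compl_insert, ← hΛ]
      exact Finset.card_erase_lt_of_mem (Finset.mem_compl.2 hi)
    · rw [pin_insert_of_eq_one w rfl, ← hv]
      simpa [hxi] using hx
    · rw [pin_insert_of_eq_one w rfl, ← hv]
      simpa [hui] using hvu
  have hnot : ∀ x i, v x ≠ 0 → bit x i = 0 → i ∉ Λ := fun x i hx h hi => by
    rw [bit_eq_one_iff.2 (agree_of_pin_ne_zero hx i hi)] at h
    norm_num at h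
  exact hxy ((hmerge x i hx hxi hui (hnot y i hy hyi)).trans
    (hmerge y j hy hyj huj (hnot x j hx hxj)).symm)

end Weights

end MatrixBernstein

namespace MatrixBernstein

open MeasureTheory ProbabilityTheory Matrix NormedSpace

/-! ### From measures to weights -/

section Measure

variable {n : ℕ} {μ : Measure (Cube n)}

/-- The weight of a point under a measure on the cube. -/
noncomputable def pointMass (μ : Measure (Cube n)) (x : Cube n) : ℝ := μ.real {x}

theorem pointMass_nonneg (x : Cube n) : 0 ≤ pointMass μ x := measureReal_nonneg

/-- The weight `v` is the restriction of `μ` to the event `S`. -/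
structure IsRestriction (μ : Measure (Cube n)) (v : Cube n → ℝ) (S : Set (Cube n)) : Prop where
  eq_pointMass : ∀ x ∈ S, v x = pointMass μ x
  eq_zero : ∀ x ∉ S, v x = 0

theorem isRestriction_univ : IsRestriction μ (pointMass μ) Set.univ :=
  ⟨fun _ _ => rfl, fun x hx => absurd (Set.mem_univ x) hx⟩

theorem isRestriction_pin (Λ : Finset (Fin n)) (σ : Cube n) :
    IsRestriction μ (pin (pointMass μ) Λ σ) (pinEvent Λ fun l => σ l) :=
  ⟨fun _ hx => if_pos fun l hl => hx ⟨l, hl⟩, fun _ hx => if_neg fun h => hx fun l => h l l.2⟩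

variable {v : Cube n → ℝ} {S : Set (Cube n)}

theorem IsRestriction.mul_bit (hv : IsRestriction μ v S) (i : Fin n) :
    IsRestriction μ (fun x => v x * bit x i) (coordEvent i 1 ∩ S) := by
  refine ⟨fun x hx => ?_, fun x hx => ?_⟩
  · rw [hv.eq_pointMass x hx.2, bit_eq_one_iff.2 hx.1, mul_one]
  · by_cases hS : x ∈ S
    · have : x i ≠ 1 := fun h => hx ⟨h, hS⟩
      rw [bit_eq_zero_iff.2 ((fin_two_eq _).resolve_right this), mul_zero]
    · rw [hv.eq_zero x hS, zero_mul]

theorem IsRestriction.mul_one_sub_bit (hv : IsRestriction μ v S) (i : Fin n) :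
    IsRestriction μ (fun x => v x * (1 - bit x i)) (coordEvent i 0 ∩ S) := by
  refine ⟨fun x hx => ?_, fun x hx => ?_⟩
  · rw [hv.eq_pointMass x hx.2, bit_eq_zero_iff.2 hx.1, sub_zero, mul_one]
  · by_cases hS : x ∈ S
    · have : x i ≠ 0 := fun h => hx ⟨h, hS⟩
      rw [bit_eq_one_iff.2 ((fin_two_eq _).resolve_left this), sub_self, mul_zero]
    · rw [hv.eq_zero x hS, zero_mul]

variable [IsProbabilityMeasure μ] {D : ℝ}

theorem IsRestriction.measureReal_eq (hv : IsRestriction μ v S) : μ.real S = mass v := by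
  classical
  have hS : ((Finset.univ.filter (· ∈ S) : Finset (Cube n)) : Set (Cube n)) = S := by ext; simp
  rw [← hS, ← sum_measureReal_singleton, Finset.sum_filter, mass]
  refine Finset.sum_congr rfl fun x _ => ?_
  split_ifs with hx
  exacts [(hv.eq_pointMass x hx).symm, (hv.eq_zero x hx).symm]

theorem IsRestriction.measure_pos_iff (hv : IsRestriction μ v S) : 0 < μ S ↔ 0 < mass v := by
  rw [← hv.measureReal_eq, measureReal_def, ENNReal.toReal_pos_iff,
    and_iff_left (measure_lt_top μ S)]

theorem IsRestriction.cond_real_coordEvent (hv : IsRestriction μ v S) (j : Fin n) :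
    (cond μ S).real (coordEvent j 1) = first v j / mass v := by
  rw [measureReal_def, cond_apply S.toFinite.measurableSet, ENNReal.toReal_mul,
    ENNReal.toReal_inv, Set.inter_comm, ← measureReal_def, ← measureReal_def, hv.measureReal_eq,
    (hv.mul_bit j).measureReal_eq, mass_mul_bit, inv_mul_eq_div]

theorem mass_pointMass : mass (pointMass μ) = 1 := by
  rw [← isRestriction_univ.measureReal_eq, probReal_univ]

theorem sum_abs_le_linftyNorm (M : Matrix (Fin n) (Fin n) ℝ) (i : Fin n) :
    ∑ j, |M i j| ≤ linftyNorm M :=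
  le_ciSup (f := fun i => ∑ j, |M i j|) (Set.finite_range _).bddAbove i

theorem second_eq_zero_of_first_eq_zero (hv : ∀ x, 0 ≤ v x) {i : Fin n} (h : first v i = 0)
    (j : Fin n) : second v i j = 0 := by
  refine Finset.sum_eq_zero fun x _ => ?_
  rw [eq_zero_of_mass_eq_zero (v := fun x => v x * bit x i)
    (fun x => mul_nonneg (hv x) (bit_nonneg x i)) h x, zero_mul]

theorem second_eq_first_of_first_eq_mass (hv : ∀ x, 0 ≤ v x) {i : Fin n}
    (h : first v i = mass v) (j : Fin n) : second v i j = first v j := by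
  have h0 : mass (fun x => v x * (1 - bit x i)) = 0 := by
    rw [mass_mul_one_sub_bit, h, sub_self]
  refine Finset.sum_congr rfl fun x _ => ?_
  have := eq_zero_of_mass_eq_zero
    (fun x => mul_nonneg (hv x) (sub_nonneg.2 (bit_le_one x i))) h0 x
  linear_combination -(bit x j) * this

/-- Row `i` of the scaled covariance is row `i` of `psiMatrix` times `first v i (mass v - first v i)
/ mass v`. If a conditioning event is null, both sides vanish. -/
theorem TwoSidedIndep.sum_abs_scaledCov_le (h : TwoSidedIndep μ D) (Λ : Finset (Fin n))
    (σ : Cube n) (i : Fin n) :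
    ∑ j, |scaledCov (pin (pointMass μ) Λ σ) i j| ≤ D * (first (pin (pointMass μ) Λ σ) i *
      (mass (pin (pointMass μ) Λ σ) - first (pin (pointMass μ) Λ σ) i)
        / mass (pin (pointMass μ) Λ σ)) := by
  set v := pin (pointMass μ) Λ σ with hvdef
  have hv : IsRestriction μ v (pinEvent Λ fun l => σ l) := isRestriction_pin Λ σ
  have hv0 : ∀ x, 0 ≤ v x := pin_nonneg pointMass_nonneg Λ σ
  rcases (first_nonneg hv0 i).eq_or_lt with h0 | h0
  · simp [scaledCov, ← h0, second_eq_zero_of_first_eq_zero hv0 h0.symm]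
  have hm : 0 < mass v := h0.trans_le (first_le_mass hv0 i)
  rcases (first_le_mass hv0 i).eq_or_lt with h1 | h1
  · have : ∀ j, scaledCov v i j = 0 := fun j => by
      rw [scaledCov, second_eq_first_of_first_eq_mass hv0 h1, h1]
      field_simp
      simp
    simp [this, h1]
  · have hm' : 0 < mass v - first v i := sub_pos.2 h1
    have hpsi : ∀ j, |scaledCov v i j| = first v i * (mass v - first v i) / mass v *
        |psiMatrix μ Λ (fun l => σ l) i j| := fun j => by
      have hc : 0 < μ (coordEvent i 1 ∩ pinEvent Λ fun l => σ l) ∧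
          0 < μ (coordEvent i 0 ∩ pinEvent Λ fun l => σ l) := by
        rw [(hv.mul_bit i).measure_pos_iff, (hv.mul_one_sub_bit i).measure_pos_iff,
          mass_mul_one_sub_bit]
        exact ⟨h0, hm'⟩
      have hval : psiMatrix μ Λ (fun l => σ l) i j = second v i j / first v i
          - (first v j - second v i j) / (mass v - first v i) := by
        rw [psiMatrix, of_apply, if_pos hc, (hv.mul_bit i).cond_real_coordEvent,
          (hv.mul_one_sub_bit i).cond_real_coordEvent, first_mul_bit, mass_mul_bit,
          first_mul_one_sub_bit, mass_mul_one_sub_bit]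
      rw [hval, ← abs_of_pos (div_pos (mul_pos h0 hm') hm), ← abs_mul]
      congr 1
      rw [scaledCov]
      field_simp
      ring
    simp only [hpsi, ← Finset.mul_sum]
    rw [mul_comm D]
    exact mul_le_mul_of_nonneg_left ((sum_abs_le_linftyNorm _ i).trans (h Λ _))
      (div_pos (mul_pos h0 hm') hm).le

/-- Here the proportionality factor to `influenceMatrix` is `first v i`. -/
theorem OneSidedIndep.sum_abs_scaledCov_le (h : OneSidedIndep μ D) (Λ : Finset (Fin n))
    (i : Fin n) :
    ∑ j, |scaledCov (pin (pointMass μ) Λ fun _ => 1) i j|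
      ≤ D * first (pin (pointMass μ) Λ fun _ => 1) i := by
  set v := pin (pointMass μ) Λ (fun _ => 1) with hvdef
  have hv : IsRestriction μ v (pinEvent Λ fun _ => 1) := isRestriction_pin Λ fun _ => 1
  have hv0 : ∀ x, 0 ≤ v x := pin_nonneg pointMass_nonneg Λ _
  rcases (first_nonneg hv0 i).eq_or_lt with h0 | h0
  · simp [scaledCov, ← h0, second_eq_zero_of_first_eq_zero hv0 h0.symm]
  have hm : 0 < mass v := h0.trans_le (first_le_mass hv0 i)
  have hinf : ∀ j, |scaledCov v i j| = first v i * |influenceMatrix μ Λ i j| := fun j => by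
    have hc : 0 < μ (coordEvent i 1 ∩ pinEvent Λ fun _ => 1) := by
      rwa [(hv.mul_bit i).measure_pos_iff]
    have hval : influenceMatrix μ Λ i j = second v i j / first v i - first v j / mass v := by
      rw [influenceMatrix, of_apply, if_pos hc, (hv.mul_bit i).cond_real_coordEvent,
        hv.cond_real_coordEvent, first_mul_bit, mass_mul_bit]
    rw [hval, ← abs_of_pos h0, ← abs_mul, abs_of_pos h0]
    congr 1
    rw [scaledCov]
    field_simp
  simp only [hinf, ← Finset.mul_sum]
  rw [mul_comm D]
  exact mul_le_mul_of_nonneg_left ((sum_abs_le_linftyNorm _ i).trans (h Λ)) h0.le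

omit [IsProbabilityMeasure μ] in
theorem pointMass_ne_zero {x : Cube n} (h : pointMass μ x ≠ 0) : μ {x} ≠ 0 := fun h0 =>
  h (by rw [pointMass, measureReal_def, h0, ENNReal.toReal_zero])

omit [IsProbabilityMeasure μ] in
theorem IsHomogeneous.sum_bit_eq {k : ℕ} (h : IsHomogeneous μ k) (x : Cube n)
    (hx : pointMass μ x ≠ 0) : ∑ i, bit x i = k := by
  have := ae_iff_of_countable.1 h x (pointMass_ne_zero hx)
  simp only [bit, ← this, Nat.cast_sum]

theorem StepDecreasing.sum_pointMass_mul_le {F : (Fin n → ℝ) → ℝ} {g h : ℝ}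
    (hF : StepDecreasing F g h D) (hD : 0 ≤ D)
    (hμ : (∃ k, IsHomogeneous μ k ∧ OneSidedIndep μ D) ∨ TwoSidedIndep μ D) :
    ∑ x, pointMass μ x * F (fun j => (g - h) * bit x j)
      ≤ F (fun j => g * first (pointMass μ) j) := by
  rcases hμ with ⟨k, hk, h1⟩ | h2
  · have := hF.sum_pin_mul_le_of_oneSided hD pointMass_nonneg hk.sum_bit_eq
      h1.sum_abs_scaledCov_le _ ∅ rfl
    simpa [pin_empty, mass_pointMass] using this
  · have := hF.sum_pin_mul_le_of_twoSided hD pointMass_nonneg h2.sum_abs_scaledCov_le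
      _ ∅ (fun _ => 0) rfl
    simpa [pin_empty, mass_pointMass] using this

theorem eq_of_indep_lt_one (hD : D < 1)
    (hμ : (∃ k, IsHomogeneous μ k ∧ OneSidedIndep μ D) ∨ TwoSidedIndep μ D) {x y : Cube n}
    (hx : pointMass μ x ≠ 0) (hy : pointMass μ y ≠ 0) : x = y := by
  rcases hμ with ⟨k, hk, h1⟩ | h2
  · refine eq_of_oneSided_lt_one hD pointMass_nonneg hk.sum_bit_eq h1.sum_abs_scaledCov_le _ ∅ rfl
      x y ?_ ?_ <;> rwa [pin_empty]
  · refine eq_of_twoSided_lt_one hD pointMass_nonneg (fun i => ?_) hx hy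
    simpa only [pin_empty] using h2.sum_abs_scaledCov_le ∅ (fun _ => 0) i

/-! ### The tail bound -/

variable {d : ℕ} {A : Fin n → Matrix (Fin d) (Fin d) ℝ}

theorem matrixSum_eq (A : Fin n → Matrix (Fin d) (Fin d) ℝ) (x : Cube n) :
    matrixSum A x = ∑ j, bit x j • A j := rfl

theorem posSemidef_matrixSum (hA : ∀ i, (A i).PosSemidef) (x : Cube n) :
    (matrixSum A x).PosSemidef := by
  rw [matrixSum_eq]
  exact posSemidef_sum _ fun j _ => (hA j).smul (bit_nonneg x j)

theorem integral_matrixSum (A : Fin n → Matrix (Fin d) (Fin d) ℝ) :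
    ∫ x, matrixSum A x ∂μ = ∑ x, pointMass μ x • matrixSum A x :=
  integral_fintype .of_finite

theorem integral_matrixSum_eq_sum_first (A : Fin n → Matrix (Fin d) (Fin d) ℝ) :
    ∫ x, matrixSum A x ∂μ = ∑ j, first (pointMass μ) j • A j := by
  rw [integral_matrixSum]
  simp only [matrixSum_eq, first, Finset.sum_smul, Finset.smul_sum, smul_smul]
  rw [Finset.sum_comm]

/-- The parameters are `g = θ + h` and `h = 18 θ² D² R`. Since `hθ1` gives `h ≤ θ`, one has `g ≤
2θ`, and the second-order cost is at most `16 θ² D² R + 2 θ² D² R = h`. -/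
theorem sum_pointMass_mul_trace_exp_le [Nonempty (Fin d)] (hA : ∀ i, (A i).PosSemidef) {R θ : ℝ}
    (hR : ∀ i, ‖A i‖ ≤ R) (hR0 : 0 ≤ R) (hD : 1 ≤ D) (hθ : 0 ≤ θ) (hθ1 : 18 * θ * D ^ 2 * R ≤ 1)
    (hμ : (∃ k, IsHomogeneous μ k ∧ OneSidedIndep μ D) ∨ TwoSidedIndep μ D) :
    ∑ x, pointMass μ x * (exp (θ • matrixSum A x)).trace
      ≤ d * Real.exp ((θ + 18 * θ ^ 2 * D ^ 2 * R) * ‖∫ x, matrixSum A x ∂μ‖) := by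
  set h := 18 * θ ^ 2 * D ^ 2 * R with hh
  have hh0 : 0 ≤ h := by positivity
  have hhθ : h ≤ θ := by
    have := mul_le_mul_of_nonneg_left hθ1 hθ
    rw [hh]; linarith
  have hD2 : D ≤ D ^ 2 := by nlinarith
  have hD1 : 1 ≤ D ^ 2 := by nlinarith
  have hθR : 0 ≤ θ * R := by positivity
  have hstep : StepDecreasing (fun u => (exp (∑ j, u j • A j)).trace) (θ + h) h D := by
    refine stepDecreasing_trace_exp hA hR0 hR (by positivity) hh0 (by linarith) ?_ ?_
    · have e1 : (θ + h) * D * R ≤ 2 * θ * D ^ 2 * R := by gcongr; linarith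
      have e2 : h * R ≤ θ * D ^ 2 * R := by
        gcongr
        nlinarith
      nlinarith
    · have e1 : 4 * (θ + h) ^ 2 * D ^ 2 * R ≤ 4 * (2 * θ) ^ 2 * D ^ 2 * R := by gcongr; linarith
      have e2 : 2 * h ^ 2 * R ≤ 2 * θ ^ 2 * D ^ 2 * R := by
        calc 2 * h ^ 2 * R ≤ 2 * θ ^ 2 * 1 * R := by rw [mul_one]; gcongr
          _ ≤ 2 * θ ^ 2 * D ^ 2 * R := by gcongr
      rw [hh] at *
      linarith
  have hmain := hstep.sum_pointMass_mul_le (by linarith) hμ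
  have e1 : ∀ x : Cube n, ∑ j, ((θ + h - h) * bit x j) • A j = θ • matrixSum A x := fun x => by
    rw [matrixSum_eq, Finset.smul_sum]
    simp only [add_sub_cancel_right, smul_smul]
  have e2 : ∑ j, ((θ + h) * first (pointMass μ) j) • A j
      = (θ + h) • ∫ x, matrixSum A x ∂μ := by
    rw [integral_matrixSum_eq_sum_first, Finset.smul_sum]
    simp only [smul_smul]
  simp only [e1, e2] at hmain
  refine hmain.trans ?_
  have hherm : ((θ + h) • ∫ x, matrixSum A x ∂μ).IsHermitian := by
    rw [← e2]; exact isHermitian_sum_smul hA _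
  refine (trace_exp_le hherm).trans_eq ?_
  rw [norm_smul, Real.norm_of_nonneg (by positivity), Fintype.card_fin]

/-- Markov's inequality for `tr exp(θ Z)`, which dominates `exp(θ ‖Z‖)`. Condition `hθ2` lets the
quadratic correction use up only half of the gain `θ t`. -/
theorem measureReal_norm_matrixSum_ge_le [Nonempty (Fin d)] (hA : ∀ i, (A i).PosSemidef)
    {R θ t : ℝ} (hR : ∀ i, ‖A i‖ ≤ R) (hR0 : 0 ≤ R) (hD : 1 ≤ D) (hθ : 0 ≤ θ)
    (hθ1 : 18 * θ * D ^ 2 * R ≤ 1)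
    (hθ2 : 18 * θ ^ 2 * D ^ 2 * R * ‖∫ x, matrixSum A x ∂μ‖ ≤ θ * t / 2)
    (hμ : (∃ k, IsHomogeneous μ k ∧ OneSidedIndep μ D) ∨ TwoSidedIndep μ D) :
    μ.real {x | ‖∫ x, matrixSum A x ∂μ‖ + t ≤ ‖matrixSum A x‖}
      ≤ d * Real.exp (-(θ * t / 2)) := by
  classical
  set N := ‖∫ x, matrixSum A x ∂μ‖ with hN
  set S := {x : Cube n | N + t ≤ ‖matrixSum A x‖} with hS
  have hmass : μ.real S = ∑ x, if x ∈ S then pointMass μ x else 0 :=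
    IsRestriction.measureReal_eq (v := fun x => if x ∈ S then pointMass μ x else 0)
      ⟨fun x hx => if_pos hx, fun x hx => if_neg hx⟩
  have hle : μ.real S ≤ Real.exp (-(θ * (N + t)))
      * ∑ x, pointMass μ x * (exp (θ • matrixSum A x)).trace := by
    rw [hmass, Finset.mul_sum]
    refine Finset.sum_le_sum fun x _ => ?_
    have hpsd : (θ • matrixSum A x).PosSemidef := (posSemidef_matrixSum hA x).smul hθ
    have htr := exp_norm_le_trace_exp hpsd
    rw [norm_smul, Real.norm_of_nonneg hθ] at htr
    have h0 : 0 ≤ (exp (θ • matrixSum A x)).trace := (Real.exp_pos _).le.trans htr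
    split_ifs with hx
    · have h1 : 1 ≤ Real.exp (-(θ * (N + t))) * (exp (θ • matrixSum A x)).trace := by
        refine le_trans ?_ (mul_le_mul_of_nonneg_left htr (Real.exp_pos _).le)
        rw [← Real.exp_add]
        refine Real.one_le_exp ?_
        have := mul_le_mul_of_nonneg_left (show N + t ≤ ‖matrixSum A x‖ from hx) hθ
        linarith
      have := mul_le_mul_of_nonneg_left h1 (pointMass_nonneg (μ := μ) x)
      linarith
    · exact mul_nonneg (Real.exp_pos _).le (mul_nonneg (pointMass_nonneg x) h0)
  refine hle.trans ((mul_le_mul_of_nonneg_left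
    (sum_pointMass_mul_trace_exp_le hA hR hR0 hD hθ hθ1 hμ) (Real.exp_pos _).le).trans ?_)
  rw [mul_left_comm, ← Real.exp_add]
  gcongr
  rw [← hN]
  linarith

end Measure

end MatrixBernstein

namespace MatrixBernstein

open MeasureTheory ProbabilityTheory

/-! ### Choice of `θ` and the tail bound in extended reals. -/

section Tail

variable {n d : ℕ} {μ : Measure (Cube n)} [IsProbabilityMeasure μ] {D : ℝ}
  {A : Fin n → Matrix (Fin d) (Fin d) ℝ}

theorem measure_norm_matrixSum_ge_eq_zero (hD : D < 1)
    (hμ : (∃ k, IsHomogeneous μ k ∧ OneSidedIndep μ D) ∨ TwoSidedIndep μ D) {t : ℝ} (ht : 0 < t) :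
    μ {x | ‖∫ x, matrixSum A x ∂μ‖ + t ≤ ‖matrixSum A x‖} = 0 := by
  refine (measure_eq_zero_iff_ae_notMem).2 (ae_iff_of_countable.2 fun x hx => ?_)
  have hx' : pointMass μ x ≠ 0 := fun h =>
    hx ((measureReal_eq_zero_iff (measure_ne_top μ _)).1 h)
  have hzero : ∀ y, y ≠ x → pointMass μ y = 0 := fun y hy => by
    by_contra h
    exact hy (eq_of_indep_lt_one hD hμ h hx')
  have h1 : pointMass μ x = 1 := by
    rw [← mass_pointMass (μ := μ), mass, Finset.sum_eq_single x (fun y _ hy => hzero y hy) (by simp)]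
  have hmean : ∫ x, matrixSum A x ∂μ = matrixSum A x := by
    rw [integral_matrixSum, Finset.sum_eq_single x (fun y _ hy => by rw [hzero y hy, zero_smul])
      (by simp), h1, one_smul]
  simp only [Set.mem_ofPred_eq, hmean]
  linarith

theorem exp_neg_ofReal (a : ℝ) (ha : 0 ≤ a) :
    EReal.exp (-((ENNReal.ofReal a : ℝ≥0∞) : EReal)) = ENNReal.ofReal (Real.exp (-a)) := by
  rw [EReal.coe_ennreal_ofReal, max_eq_left ha, ← EReal.coe_neg, EReal.exp_coe]

/-- The concentration bound for a law on the cube. -/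
theorem measure_norm_matrixSum_ge_le (hA : ∀ i, (A i).PosSemidef)
    (hμ : (∃ k, IsHomogeneous μ k ∧ OneSidedIndep μ D) ∨ TwoSidedIndep μ D) {t : ℝ} (ht : 0 < t) :
    μ {x | ‖∫ x, matrixSum A x ∂μ‖ + t ≤ ‖matrixSum A x‖} ≤
      2 * (d : ℝ≥0∞) * EReal.exp (-((1 / ENNReal.ofReal (72 * D ^ 2) *
        min (ENNReal.ofReal t ^ 2 / (‖∫ x, matrixSum A x ∂μ‖ₑ * ⨆ i, ‖A i‖ₑ))
          (ENNReal.ofReal t / ⨆ i, ‖A i‖ₑ) : ℝ≥0∞) : EReal)) := by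
  rcases lt_or_ge D 1 with hD | hD
  · rw [measure_norm_matrixSum_ge_eq_zero hD hμ ht]
    exact zero_le
  have hempty : (∀ x, ‖matrixSum A x‖ = 0) →
      μ {x | ‖∫ x, matrixSum A x ∂μ‖ + t ≤ ‖matrixSum A x‖} = 0 := fun h => by
    rw [← measure_empty (μ := μ)]
    congr 1
    refine Set.eq_empty_iff_forall_notMem.2 fun x hx => ?_
    have h1 : ‖∫ x, matrixSum A x ∂μ‖ + t ≤ ‖matrixSum A x‖ := hx
    rw [h x] at h1
    linarith [norm_nonneg (∫ x, matrixSum A x ∂μ)]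
  rcases isEmpty_or_nonempty (Fin d) with hd | hd
  · rw [hempty fun x => by rw [Subsingleton.elim (matrixSum A x) 0, norm_zero]]
    exact zero_le
  set R := ⨆ i, ‖A i‖ with hRdef
  have hbdd : BddAbove (Set.range fun i => ‖A i‖) := (Set.finite_range _).bddAbove
  have hR : ∀ i, ‖A i‖ ≤ R := le_ciSup hbdd
  have hR0 : 0 ≤ R := Real.iSup_nonneg fun i => norm_nonneg _
  have hRe : ⨆ i, ‖A i‖ₑ = ENNReal.ofReal R := by
    refine le_antisymm (iSup_le fun i => ?_) ?_
    · rw [← ofReal_norm]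
      exact ENNReal.ofReal_le_ofReal (hR i)
    · rcases isEmpty_or_nonempty (Fin n) with hn | hn
      · simp [hRdef, Real.iSup_of_isEmpty]
      · obtain ⟨i, hi⟩ := exists_eq_ciSup_of_finite (f := fun i => ‖A i‖)
        rw [hRdef, ← hi, ofReal_norm]
        exact le_iSup (fun i => ‖A i‖ₑ) i
  rcases hR0.eq_or_lt with h0 | hRpos
  · have hA0 : ∀ i, A i = 0 := fun i => norm_le_zero_iff.1 (h0 ▸ hR i)
    rw [hempty fun x => by simp [matrixSum, hA0]]
    exact zero_le
  set N := ‖∫ x, matrixSum A x ∂μ‖ with hN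
  have hN0 : 0 ≤ N := norm_nonneg _
  have hDpos : 0 < D := by linarith
  rw [hRe, ← ofReal_norm, ← hN]
  have key : ∀ θ : ℝ, 0 ≤ θ → 18 * θ * D ^ 2 * R ≤ 1 →
      18 * θ ^ 2 * D ^ 2 * R * N ≤ θ * t / 2 →
      1 / ENNReal.ofReal (72 * D ^ 2) * min (ENNReal.ofReal t ^ 2 / (ENNReal.ofReal N *
        ENNReal.ofReal R)) (ENNReal.ofReal t / ENNReal.ofReal R) ≤ ENNReal.ofReal (θ * t / 2) →
      μ {x | N + t ≤ ‖matrixSum A x‖} ≤ 2 * (d : ℝ≥0∞) * EReal.exp (-((1 / ENNReal.ofReal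
        (72 * D ^ 2) * min (ENNReal.ofReal t ^ 2 / (ENNReal.ofReal N * ENNReal.ofReal R))
          (ENNReal.ofReal t / ENNReal.ofReal R) : ℝ≥0∞) : EReal)) := by
    intro θ hθ h1 h2 h3
    have h4 := measureReal_norm_matrixSum_ge_le hA hR hR0 hD hθ h1 h2 hμ
    have h5 : μ {x | N + t ≤ ‖matrixSum A x‖}
        ≤ d * ENNReal.ofReal (Real.exp (-(θ * t / 2))) := by
      rw [← ENNReal.ofReal_natCast, ← ENNReal.ofReal_mul (Nat.cast_nonneg d)]
      rw [← ofReal_measureReal (measure_ne_top μ _)]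
      exact ENNReal.ofReal_le_ofReal h4
    rw [← exp_neg_ofReal _ (by positivity)] at h5
    refine h5.trans (mul_le_mul' ?_ (EReal.exp_monotone (EReal.neg_le_neg_iff.2 ?_)))
    -- The factor `2` in front of `d` is slack.
    · exact le_mul_of_one_le_left (zero_le) one_le_two
    · exact_mod_cast h3
  have h72 : 0 < 72 * D ^ 2 := by positivity
  -- For `t ≤ 2N` the choice of `θ` makes the second constraint of `key` an equality, and `θ t / 2 =
  -- t² / (72 D² R N)` fixes the constant `72`. For `t > 2N` it saturates the first constraint and
  -- `θ t / 2 = t / (36 D² R)`; this case includes `N = 0`.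
  rcases le_or_gt t (2 * N) with htN | htN
  · have hNpos : 0 < N := by linarith
    refine key (t / (36 * D ^ 2 * R * N)) (by positivity) ?_ ?_ ?_
    · rw [show 18 * (t / (36 * D ^ 2 * R * N)) * D ^ 2 * R = t / (2 * N) by field_simp; norm_num]
      rw [div_le_one (by positivity)]
      exact htN
    · refine le_of_eq ?_
      field_simp
      norm_num
    · refine (mul_le_mul_right (min_le_left _ _) _).trans (le_of_eq ?_)
      rw [← ENNReal.ofReal_one, ← ENNReal.ofReal_div_of_pos h72, ← ENNReal.ofReal_pow ht.le,
        ← ENNReal.ofReal_mul hN0, ← ENNReal.ofReal_div_of_pos (by positivity),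
        ← ENNReal.ofReal_mul (by positivity)]
      congr 1
      field_simp
      norm_num
  · refine key (1 / (18 * D ^ 2 * R)) (by positivity) (le_of_eq (by field_simp)) ?_ ?_
    · rw [show 18 * (1 / (18 * D ^ 2 * R)) ^ 2 * D ^ 2 * R * N = 1 / (18 * D ^ 2 * R) * N by
        field_simp, mul_div_assoc]
      gcongr
      linarith
    · refine (mul_le_mul_right (min_le_right _ _) _).trans ?_
      rw [← ENNReal.ofReal_one, ← ENNReal.ofReal_div_of_pos h72, ← ENNReal.ofReal_div_of_pos hRpos,
        ← ENNReal.ofReal_mul (by positivity)]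
      refine ENNReal.ofReal_le_ofReal ?_
      rw [div_mul_div_comm, one_mul, div_mul_eq_mul_div, one_mul, div_div]
      refine div_le_div_of_nonneg_left ht.le (by positivity) ?_
      nlinarith [mul_pos (pow_pos hDpos 2) hRpos]

end Tail

end MatrixBernstein

/-- The norm of `d × d` matrices is the `ℓ₂ → ℓ₂` operator norm (`‖·‖ₑ` is the same norm as an
extended nonnegative real). The exponent is computed in `[0, ∞]`, so that a positive number divided
by `0` is `∞`, and `EReal.exp (-∞) = 0`. -/
theorem corollary3p6 :
    ∃ C : ℝ, 0 < C ∧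
      ∀ (n d : ℕ) (Ω : Type*) [MeasurableSpace Ω] (P : MeasureTheory.Measure Ω)
        [MeasureTheory.IsProbabilityMeasure P]
        (X : Ω → MatrixBernstein.Cube n) (_ : Measurable X) (D : ℝ)
        (_ : (∃ k : ℕ, MatrixBernstein.IsHomogeneous (P.map X) k ∧
                MatrixBernstein.OneSidedIndep (P.map X) D) ∨
              MatrixBernstein.TwoSidedIndep (P.map X) D)
        (A : Fin n → Matrix (Fin d) (Fin d) ℝ) (_ : ∀ i, (A i).PosSemidef)
        (Z : Ω → Matrix (Fin d) (Fin d) ℝ) (_ : Z = fun ω => MatrixBernstein.matrixSum A (X ω))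
        (EZ : Matrix (Fin d) (Fin d) ℝ) (_ : EZ = ∫ ω, Z ω ∂P)
        (R : ℝ≥0∞) (_ : R = ⨆ i, ‖A i‖ₑ)
        (t : ℝ) (_ : 0 < t),
        P {ω | ‖EZ‖ + t ≤ ‖Z ω‖} ≤
          2 * (d : ℝ≥0∞) *
            EReal.exp (-((1 / ENNReal.ofReal (C * D ^ 2) *
              min (ENNReal.ofReal t ^ 2 / (‖EZ‖ₑ * R)) (ENNReal.ofReal t / R) : ℝ≥0∞) : EReal)) := by
  refine ⟨72, by norm_num, ?_⟩
  intro n d Ω _ P _ X hX D hD A hA Z hZ EZ hEZ R hR t ht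
  have hP : MeasureTheory.IsProbabilityMeasure (P.map X) :=
    MeasureTheory.Measure.isProbabilityMeasure_map hX.aemeasurable
  have hmean : EZ = ∫ x, MatrixBernstein.matrixSum A x ∂(P.map X) := by
    rw [hEZ, hZ, MeasureTheory.integral_map hX.aemeasurable .of_discrete]
  have hmap : P {ω | ‖EZ‖ + t ≤ ‖Z ω‖}
      = P.map X {x | ‖EZ‖ + t ≤ ‖MatrixBernstein.matrixSum A x‖} := by
    rw [MeasureTheory.Measure.map_apply hX (Set.toFinite _).measurableSet, hZ]
    rfl
  rw [hmap, hmean, hR]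
  exact MatrixBernstein.measure_norm_matrixSum_ge_le hA hD ht
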